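/- **Proposition.** Let $G(\mathbb C)\cong(\mathbb C^\times)^n$ be an algebraic torus defined over $\mathbb R$, with complex conjugation $\sigma$, real points $G=G(\mathbb C)^\sigma$ and real Lie algebra $\mathfrak g$. Let $p:\widetilde G\to G$ be a two-fold cover (a surjective homomorphism of topological groups that is a covering map with kernel of order two), and let $Z(\widetilde G)$ be the center of $\widetilde G$. Let $C$ be a subgroup of $p(Z(\widetilde G))$ with $c^2=1$ for all $c\in C$, let $\overline G$ be the group of real points of $G(\mathbb C)/C$, and let $\phi:\overline G\to G$ be the homomorphism $\phi(h)=s(h)^2$, where $s(h)\in G(\mathbb C)$ is any preimage of $h$. Characters are continuous homomorphisms to $\mathbb C^\times$, and representations are continuous, finite-dimensional and complex; a character of a subgroup containing $\mathrm{Ker}(p)$, or a representation of $\widetilde G$, is genuine if the nontrivial element of $\mathrm{Ker}(p)$ acts by $-1$. Let $X_g(Z(\widetilde G))$ be the set of genuine characters of $Z(\widetilde G)$. For every $\widetilde\psi\in X_g(Z(\widetilde G))$ there is, up to isomorphism, exactly one irreducible genuine representation $\widetilde\tau(\widetilde\psi)$ of $\widetilde G$ on which $Z(\widetilde G)$ acts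 by $\widetilde\psi$. For $\tilde g\in\widetilde G$ put $X(\overline G,\tilde g)=\{h\in\overline G: \phi(h)=p(\tilde g)\}$, a finite set, and let $\widetilde S=p^{-1}(\phi(\overline G))$; then $\widetilde S\subset Z(\widetilde G)$. Fix $\widetilde\chi\in X_g(Z(\widetilde G))$ and a character $\chi$ of $\overline G$. For a character $\psi$ of $\overline G$ define the function $$\mathrm{Lift}(\psi)(\tilde g)=c^{-1}\sum_{h\in X(\overline G,\tilde g)}\widetilde\chi(\tilde g)\chi(h)^{-1}\psi(h)\qquad(\tilde g\in\widetilde G)$$ (the sum is empty if $\tilde g\notin\widetilde S$), where $$c=|\mathrm{Ker}(\phi)|\,|G/p(Z(\widetilde G))|^{-1/2}\,|p(Z(\widetilde G))/\phi(\overline G)|^{-1}.$$ Then $\mathrm{Lift}(\psi)\neq0$ if and only if $\chi(t)=\psi(t)$ for all $t\in\mathrm{Ker}(\phi)$. Assume this holds. Then $\widetilde\psi_0(\tilde g)=\widetilde\chi(\tilde g)\psi(h)\chi(h)^{-1}$ (for $\tilde g\in\widetilde S$ and any $h\in X(\overline G,\tilde g)$) is a well-defined genuine character of $\widetilde S$.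 Let $X_g(Z(\widetilde G),\widetilde\psi_0)$ be the set of $\widetilde\psi\in X_g(Z(\widetilde G))$ with $\widetilde\psi|_{\widetilde S}=\widetilde\psi_0$. This set is finite with exactly $|p(Z(\widetilde G))/\phi(\overline G)|$ elements, and $$\mathrm{Lift}(\psi)=\sum_{\widetilde\psi\in X_g(Z(\widetilde G),\widetilde\psi_0)}\widetilde\tau(\widetilde\psi)$$ as an identity of genuine representations: $\mathrm{Lift}(\psi)$ is the character of the direct sum of the $\widetilde\tau(\widetilde\psi)$, and every completely reducible genuine representation with character $\mathrm{Lift}(\psi)$ is isomorphic to this direct sum. Identify the Lie algebras of $\widetilde G$, $Z(\widetilde G)$ and $\overline G$ with $\mathfrak g$ through the differentials of $p$ and of the projection $G\to\overline G$. Then every $\widetilde\psi\in X_g(Z(\widetilde G),\widetilde\psi_0)$ has differential $$d\widetilde\psi=\tfrac12(d\psi-d\mu),\qquad d\mu=d\chi-2\,d\widetilde\chi\in\mathfrak g(\mathbb C)^*.$$ In particular, if $\phi(\overline G)=p(Z(\widetilde G))$, then $\widetilde S=Z(\widetilde G)$, the set $X_g(Z(\widetilde G),\widetilde\psi_0)$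 consists of the single character $\widetilde\psi_0$, and $\mathrm{Lift}(\psi)=\widetilde\tau(\widetilde\psi_0)$ in the same sense. -/

import Mathlib

universe u v w

noncomputable section

/-- An algebraic torus defined over `ℝ`, in coordinates: the complex torus `(ℂˣ)ⁿ` together with
the action `σ` of complex conjugation, an involutive group automorphism that is anti-algebraic,
i.e. every coordinate of `σ z` is a Laurent monomial in the conjugates of the coordinates of `z`
(algebraic homomorphisms between tori are exactly those given by Laurent monomials). -/
structure RealTorus where
  n : ℕ
  σ : (Fin n → ℂˣ) →* (Fin n → ℂˣ)
  σ_invol : ∀ z, σ (σ z) = z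
  σ_antialgebraic : ∀ i, ∃ a : Fin n → ℤ, ∀ z, σ z i = ∏ j, star (z j) ^ a j

namespace RealTorus

variable (T : RealTorus)

/-- The group of complex points `G(ℂ)`. -/
abbrev GC : Type := Fin T.n → ℂˣ

/-- The group of real points `G = G(ℂ)^σ`, with the subspace topology. -/
def G : Subgroup T.GC := T.σ.eqLocus (MonoidHom.id _)

lemma mem_G {z : T.GC} : z ∈ T.G ↔ T.σ z = z := Iff.rfl

/-- The exponential map of `G(ℂ)`, whose Lie algebra is `ℂⁿ`. -/
def exp (X : Fin T.n → ℂ) : T.GC := fun i => Units.mk0 (Complex.exp (X i)) (Complex.exp_ne_zero _)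

lemma exp_add (X Y : Fin T.n → ℂ) : T.exp (X + Y) = T.exp X * T.exp Y := by
  funext i; ext; simp [exp, Complex.exp_add]

lemma exp_zero : T.exp 0 = 1 := by
  funext i; ext; simp [exp]

/-- The real Lie algebra `𝔤` of `G`: all `X` whose one-parameter group `exp (tX)` stays in `G`. -/
def lie : Submodule ℝ (Fin T.n → ℂ) where
  carrier := {X | ∀ t : ℝ, T.exp (t • X) ∈ T.G}
  add_mem' hX hY t := by
    rw [smul_add, exp_add]; exact mul_mem (hX t) (hY t)
  zero_mem' t := by
    rw [smul_zero, exp_zero]; exact one_mem _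
  smul_mem' c X hX t := by
    rw [smul_smul]; exact hX (t * c)

/-- The exponential map `𝔤 → G`. -/
def expG (X : T.lie) : T.G := ⟨T.exp X, by simpa using X.2 1⟩

end RealTorus

/-- A two-fold cover `p : G̃ → G` of the real points of `T`: a surjective group homomorphism from
a topological group that is a covering map with kernel of order two. -/
structure TwoFoldCover (T : RealTorus) (Gt : Type u) [Group Gt] [TopologicalSpace Gt]
    [IsTopologicalGroup Gt] where
  p : Gt →* T.G
  surjective : Function.Surjective p
  isCoveringMap : IsCoveringMap p
  card_ker : Nat.card p.ker = 2

namespace TwoFoldCover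

variable {T : RealTorus} {Gt : Type u} [Group Gt] [TopologicalSpace Gt] [IsTopologicalGroup Gt]
  (P : TwoFoldCover T Gt)

/-- The subgroup `p(Z(G̃))` of `G`. -/
def Z0 : Subgroup T.G := (Subgroup.center Gt).map P.p

/-- A (continuous) character of a subgroup `A` of `G̃` is genuine if it takes the value `-1` at the
non-trivial element of the kernel of `p` (when that element lies in `A`; it always lies in the
subgroups to which this is applied, `Z(G̃)` and the full preimage of a subgroup of `G`). -/
def IsGenuine {A : Subgroup Gt} (χ : A →ₜ* ℂˣ) : Prop :=
  ∀ a : A, P.p a = 1 → a ≠ 1 → χ a = -1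

/-- The set `X_g(Z(G̃))` of genuine characters of the centre of `G̃`. -/
def GenuineChar : Type u := {χ : Subgroup.center Gt →ₜ* ℂˣ // P.IsGenuine χ}

/-- `d` is the differential of the character `χ` of `Z(G̃)`, as a linear functional on the common
Lie algebra `𝔤` of `G`, `G̃` and `Z(G̃)` (an `ℝ`-linear map `𝔤 → ℂ` is the same as an element of
`𝔤(ℂ)^*`): the one-parameter group `exp (tX)` of `G` lifts (necessarily uniquely) to a
one-parameter group of `Z(G̃)`, and `d X` is the derivative of `χ` along it at `t = 0`. -/
def HasDifferential (χ : Subgroup.center Gt →ₜ* ℂˣ) (d : T.lie →ₗ[ℝ] ℂ) : Prop :=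
  ∀ X : T.lie, ∃ γ : Multiplicative ℝ →ₜ* Subgroup.center Gt,
    (∀ t : ℝ, P.p (γ (Multiplicative.ofAdd t)) = T.expG (t • X)) ∧
      HasDerivAt (fun t : ℝ => ((χ (γ (Multiplicative.ofAdd t)) : ℂˣ) : ℂ)) (d X) 0

/-- A genuine representation of `G̃`: a continuous finite-dimensional complex representation in
which the non-trivial element of the kernel of `p` acts by `-1`. -/
structure GenuineRep where
  V : Type v
  [addCommGroup : AddCommGroup V]
  [module : Module ℂ V]
  [finiteDimensional : FiniteDimensional ℂ V]
  ρ : Representation ℂ Gt V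
  continuous_coeff : ∀ (f : V →ₗ[ℂ] ℂ) (x : V), Continuous fun g => f (ρ g x)
  genuine : ∀ g : Gt, P.p g = 1 → g ≠ 1 → ∀ x : V, ρ g x = -x

attribute [instance] GenuineRep.addCommGroup GenuineRep.module GenuineRep.finiteDimensional

namespace GenuineRep

variable {P}

/-- The character `Θ_π` of a representation, as a function on `G̃`. -/
def character (π : GenuineRep.{u, v} P) (g : Gt) : ℂ := LinearMap.trace ℂ π.V (π.ρ g)

/-- Isomorphism of representations. -/
def Iso (π : GenuineRep.{u, v} P) (π' : GenuineRep.{u, w} P) : Prop := Nonempty (π.ρ.Equiv π'.ρ)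

/-- The direct sum of a finite family of genuine representations. -/
def directSum {ι : Type u} [Finite ι] (τ : ι → GenuineRep.{u, v} P) :
    GenuineRep.{u, max u v} P where
  V := DirectSum ι fun i => (τ i).V
  finiteDimensional := by
    classical
    have := Fintype.ofFinite ι
    exact Module.Finite.equiv (DirectSum.linearEquivFunOnFintype ℂ ι fun i => (τ i).V).symm
  ρ := Representation.directSum fun i => (τ i).ρ
  continuous_coeff f x := by
    classical
    induction x using DirectSum.induction_on with
    | zero => simpa using continuous_const
    | of i y =>
      have h := (τ i).continuous_coeff (f ∘ₗ DirectSum.lof ℂ ι (fun i => (τ i).V) i) y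
      refine h.congr fun g => ?_
      rw [← DirectSum.lof_eq_of ℂ, Representation.directSum_apply, DirectSum.lmap_lof]
      rfl
    | add x y hx hy => exact (hx.add hy).congr fun g => by simp
  genuine g hg hg1 x := by
    classical
    induction x using DirectSum.induction_on with
    | zero => simp
    | of i y =>
      rw [← DirectSum.lof_eq_of ℂ, Representation.directSum_apply, DirectSum.lmap_lof,
        (τ i).genuine g hg hg1, map_neg]
    | add x y hx hy => rw [map_add, hx, hy, neg_add]

/-- `τ` is the representation `τ̃(ψ̃)`: irreducible, with `Z(G̃)` acting by the character `ψ̃`. -/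
def IsTau (τ : GenuineRep.{u, v} P) (ψt : P.GenuineChar) : Prop :=
  τ.ρ.IsIrreducible ∧ ∀ (z : Subgroup.center Gt) (x : τ.V), τ.ρ z x = ((ψt.1 z : ℂˣ) : ℂ) • x

/-- `π` is the representation identified with the function `Θ` on `G̃`: it is a direct sum of
irreducible representations and has character `Θ`. -/
def Represents (π : GenuineRep.{u, v} P) (Θ : Gt → ℂ) : Prop :=
  π.ρ.IsSemisimpleRepresentation ∧ π.character = Θ

end GenuineRep

/-- A subgroup `C` of `p(Z(G̃))` (viewed inside `G(ℂ)`) all of whose elements have square `1`. -/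
structure TwoSubgroup where
  C : Subgroup T.GC
  sq_eq_one : ∀ c ∈ C, c ^ 2 = 1
  le_Z0 : C ≤ P.Z0.map T.G.subtype

namespace TwoSubgroup

variable {P} (Q : TwoSubgroup P)

lemma le_G : Q.C ≤ T.G := by
  intro c hc
  obtain ⟨z, -, rfl⟩ := Q.le_Z0 hc
  exact z.2

/-- The complex points of the quotient torus, `Ḡ(ℂ) = G(ℂ)/C`. -/
abbrev GbarC : Type := T.GC ⧸ Q.C

/-- The action of complex conjugation on `Ḡ(ℂ)`. -/
def σbar : Q.GbarC →* Q.GbarC :=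
  QuotientGroup.map Q.C Q.C T.σ fun c hc => by
    have h : T.σ c = c := Q.le_G hc
    simpa [h] using hc

/-- The group `Ḡ` of real points of `Ḡ(ℂ)`. -/
def Gbar : Subgroup Q.GbarC := Q.σbar.eqLocus (MonoidHom.id _)

/-- The projection `p̄ : G → Ḡ`. -/
def pbar : T.G →* Q.Gbar :=
  ((QuotientGroup.mk' Q.C).comp T.G.subtype).codRestrict Q.Gbar fun g => by
    change ((T.σ g : T.GC) : Q.GbarC) = ((g : T.GC) : Q.GbarC)
    rw [T.mem_G.1 g.2]

/-- The squaring map `Ḡ(ℂ) → G(ℂ)`, `h ↦ s(h)²` for any preimage `s(h)` of `h` in `G(ℂ)`. -/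
def φC : Q.GbarC →* T.GC :=
  QuotientGroup.lift Q.C (powMonoidHom 2) fun c hc => Q.sq_eq_one c hc

lemma φC_mem (h : Q.Gbar) : Q.φC h ∈ T.G := by
  obtain ⟨h, hh⟩ := h
  induction h using QuotientGroup.induction_on with
  | H g =>
    have h1 : ((T.σ g : T.GC) : Q.GbarC) = (g : Q.GbarC) := hh
    have h2 := Q.sq_eq_one _ (QuotientGroup.eq.1 h1)
    change T.σ (g ^ 2) = g ^ 2
    rw [mul_pow, inv_pow, inv_mul_eq_one] at h2
    rw [map_pow, h2]

/-- The homomorphism `φ : Ḡ → G`, `φ(h) = s(h)²`. -/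
def φ : Q.Gbar →* T.G := (Q.φC.comp Q.Gbar.subtype).codRestrict T.G Q.φC_mem

/-- The set `X(Ḡ, g̃)` of all `h` in `Ḡ` with `φ(h) = p(g̃)`. -/
def X (g : Gt) : Set Q.Gbar := {h | Q.φ h = P.p g}

lemma X_finite (g : Gt) : (Q.X g).Finite := by
  have h1 : ∀ a : ℂˣ, {w : ℂˣ | w ^ 2 = a}.Finite := fun a => by
    refine Set.Finite.of_finite_image (f := Units.val) ?_ Units.val_injective.injOn
    refine (Polynomial.nthRoots 2 (a : ℂ)).toFinset.finite_toSet.subset ?_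
    rintro _ ⟨w, hw, rfl⟩
    have h : (w : ℂ) ^ 2 = a := by
      rw [← Units.val_pow_eq_pow_val, show w ^ 2 = a from hw]
    simpa [Polynomial.mem_nthRoots] using h
  have h2 : {z : T.GC | z ^ 2 = P.p g}.Finite := by
    refine (Set.Finite.pi fun i => h1 ((P.p g : T.GC) i)).subset fun z hz i _ => ?_
    exact congrFun hz i
  refine Set.Finite.of_finite_image (f := Subtype.val) ?_ Subtype.val_injective.injOn
  refine (h2.image (QuotientGroup.mk' Q.C)).subset ?_
  rintro _ ⟨h, hh, rfl⟩
  obtain ⟨z, hz⟩ := QuotientGroup.mk'_surjective Q.C h.1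
  refine ⟨z, ?_, hz⟩
  have h3 : Q.φC h.1 = P.p g := congrArg Subtype.val hh
  rw [← hz] at h3
  exact h3

/-- The subgroup `S̃ = p⁻¹(φ(Ḡ))` of `G̃`. -/
def St : Subgroup Gt := Q.φ.range.comap P.p

/-- `d` is the differential of the character `ψ` of `Ḡ`, as a linear functional on `𝔤`, the Lie
algebra of `Ḡ` being identified with `𝔤` by the differential of `p̄`. -/
def HasDifferential (ψ : Q.Gbar →ₜ* ℂˣ) (d : T.lie →ₗ[ℝ] ℂ) : Prop :=
  ∀ X : T.lie, HasDerivAt (fun t : ℝ => ((ψ (Q.pbar (T.expG (t • X))) : ℂˣ) : ℂ)) (d X) 0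

/-- The constant `c = |Ker φ| |G/p(Z(G̃))|^{-1/2} |p(Z(G̃))/φ(Ḡ)|⁻¹`. -/
def c : ℝ :=
  (Nat.card Q.φ.ker : ℝ) * (P.Z0.index : ℝ) ^ (-(1 / 2) : ℝ) * (Q.φ.range.relIndex P.Z0 : ℝ)⁻¹

open Classical in
/-- The transfer factor `Δ(h, g̃) = χ̃(g̃) χ(h)⁻¹` for `φ(h) = p(g̃)`. Such a `g̃` lies in the
centre of `G̃` (this is part of the theorem), so the second branch is never used. -/
def transfer (χt : P.GenuineChar) (χ : Q.Gbar →ₜ* ℂˣ) (h : Q.Gbar) (g : Gt) : ℂ :=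
  if hg : g ∈ Subgroup.center Gt then ((χt.1 ⟨g, hg⟩ : ℂˣ) : ℂ) * ((χ h : ℂˣ) : ℂ)⁻¹ else 0

/-- The lift of a character `ψ` of `Ḡ`, as a function on `G̃`. -/
def lift (χt : P.GenuineChar) (χ ψ : Q.Gbar →ₜ* ℂˣ) (g : Gt) : ℂ :=
  (Q.c : ℂ)⁻¹ * ∑ h ∈ (Q.X_finite g).toFinset, Q.transfer χt χ h g * ((ψ h : ℂˣ) : ℂ)

/-- `ψ₀` is the genuine character `ψ̃₀` of `S̃`: it is given by
`ψ̃₀(g̃) = χ̃(g̃) ψ(h) χ(h)⁻¹` for every `g̃` in `S̃` and every `h` in `X(Ḡ, g̃)`. -/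
def IsPsi0 (hS : Q.St ≤ Subgroup.center Gt) (χt : P.GenuineChar) (χ ψ : Q.Gbar →ₜ* ℂˣ)
    (ψ₀ : Q.St →ₜ* ℂˣ) : Prop :=
  P.IsGenuine ψ₀ ∧
    ∀ (s : Q.St), ∀ h ∈ Q.X (s : Gt), ψ₀ s = χt.1 ⟨s, hS s.2⟩ * ψ h * (χ h)⁻¹

/-- The set `X_g(Z(G̃), ψ̃₀)` of genuine characters of `Z(G̃)` whose restriction to `S̃` is `ψ̃₀`. -/
def Xg (hS : Q.St ≤ Subgroup.center Gt) (ψ₀ : Q.St →ₜ* ℂˣ) : Set P.GenuineChar :=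
  {ψt | ∀ s : Q.St, ψt.1 ⟨s, hS s.2⟩ = ψ₀ s}

end TwoSubgroup

end TwoFoldCover

end

/-! Commutators of `G̃` lie in `Ker p`, which is central of order two. Hence squares are central,
and a non-central element `g` is conjugate to `k * g` with `k` the nontrivial kernel element. A
representation with genuine central character therefore has trace zero off the centre
(`trace_eq_zero`). Schur orthogonality over the finite group `G̃/Z(G̃)` (`sum_average`) then gives
both the uniqueness of `τ̃` and `d ^ 2 = |G/p(Z(G̃))|` for its dimension `d`; existence comes from
functions transforming by the character under the centre.

The inclusion `φ(Ḡ) ≤ p(Z(G̃))` holds because `s²` is the norm `s σ(s)`, a square in `G`, times an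
element of `C` (`range_φ_le`).

The lift sums over cosets of `Ker φ`, so it vanishes unless `χ = ψ` there. Otherwise the constant
makes it `d · |p(Z(G̃))/φ(Ḡ)| · ψ̃₀` on `S̃` and `0` elsewhere (`lift_apply_St`). The characters of
the `τ̃(ψ̃)` have the same sum: the extensions of `ψ̃₀` to the centre form a torsor under the dual
of `Z(G̃)/S̃`, so their sum vanishes off `S̃` (`sum_Xg`). A semisimple genuine representation is
recovered from its character by splitting it under the centre and using linear independence of
characters (`iso_directSum`).

The factor `1/2` in the differential arises because `φ` composed with `p̄` is squaring, so the image
of `exp (X/2)` lies in the fibre over `exp X`. -/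

noncomputable section

open Filter Topology

/-! ### Square roots, norms and the exponential map of a real torus. -/

namespace RealTorus

variable (T : RealTorus)

lemma exists_mul_self_eq (z : T.GC) : ∃ r : T.GC, r * r = z := by
  have h : ∀ i, ∃ w : ℂˣ, w * w = z i := fun i => by
    obtain ⟨w, hw⟩ := IsAlgClosed.exists_pow_nat_eq (z i : ℂ) (n := 2) two_pos
    have hw0 : w ≠ 0 := by
      rintro rfl
      exact (z i).ne_zero (by simpa using hw.symm)
    exact ⟨Units.mk0 w hw0, Units.ext (by simpa [sq] using hw)⟩
  choose r hr using h
  exact ⟨r, funext hr⟩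

lemma finite_two_torsion : {t : T.GC | t ^ 2 = 1}.Finite := by
  have h1 : {w : ℂˣ | w ^ 2 = 1}.Finite := by
    refine (Set.toFinite {1, -1}).subset fun w hw => ?_
    have h : (w : ℂ) ^ 2 = 1 := by
      rw [← Units.val_pow_eq_pow_val, show w ^ 2 = 1 from hw, Units.val_one]
    rcases sq_eq_one_iff.1 h with h | h
    · exact Or.inl (Units.ext h)
    · exact Or.inr (Units.ext (by simpa using h))
  exact (Set.Finite.pi fun _ : Fin T.n => h1).subset fun z hz i _ => congrFun hz i

/-- If `r² = g` with `g` real, then `σ(r)/r` is 2-torsion. When two elements give the same value,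
the ratio of their roots is real, so they agree modulo squares of `G`. -/
lemma finite_quotient_squares : Finite (T.G ⧸ (powMonoidHom 2 : T.G →* T.G).range) := by
  choose r hr using T.exists_mul_self_eq
  have := T.finite_two_torsion.to_subtype
  let f : T.G → {t : T.GC | t ^ 2 = 1} := fun g => ⟨T.σ (r g) / r g, by
    have h := congrArg T.σ (hr g)
    rw [map_mul, T.mem_G.1 g.2] at h
    rw [Set.mem_ofPred_eq, div_pow, sq, sq, h, hr, div_self']⟩
  refine Finite.of_injective (fun q => f (Quotient.out q)) fun a b hab => ?_
  rw [← Quotient.out_eq a, ← Quotient.out_eq b]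
  dsimp only at hab
  generalize Quotient.out a = x at *
  generalize Quotient.out b = y at *
  have h : T.σ (r x) / r x = T.σ (r y) / r y := congrArg Subtype.val hab
  refine Quotient.sound (QuotientGroup.leftRel_apply.2 ⟨⟨r y / r x, ?_⟩, ?_⟩)
  · rw [T.mem_G, map_div, div_eq_div_iff_mul_eq_mul]
    rw [div_eq_div_iff_mul_eq_mul] at h
    rw [← h, mul_comm]
  · refine Subtype.ext ?_
    change (r y / r x) ^ 2 = (x : T.GC)⁻¹ * y
    rw [div_pow, sq, sq, hr, hr, div_eq_inv_mul]

lemma exists_sq_eq_norm (s : T.GC) : ∃ g : T.G, (g : T.GC) ^ 2 = s * T.σ s := by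
  obtain ⟨r, rfl⟩ := T.exists_mul_self_eq s
  refine ⟨⟨r * T.σ r, ?_⟩, ?_⟩
  · rw [T.mem_G, map_mul, T.σ_invol, mul_comm]
  · simp only [map_mul, sq]
    exact mul_mul_mul_comm _ _ _ _

lemma continuous_σ : Continuous T.σ := by
  refine continuous_pi fun i => ?_
  obtain ⟨a, ha⟩ := T.σ_antialgebraic i
  simp_rw [ha]
  have hs : Continuous fun z : ℂˣ => star z :=
    Units.continuous_iff.2 ⟨continuous_star.comp Units.continuous_val,
      continuous_star.comp Units.continuous_coe_inv⟩
  exact continuous_finsetProd _ fun j _ => (hs.comp (continuous_apply j)).zpow _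

lemma exists_local_sqrt_units : ∃ s : ℂˣ → ℂˣ, ContinuousAt s 1 ∧ s 1 = 1 ∧ ∀ z, s z ^ 2 = z := by
  refine ⟨fun z => Units.mk0 (Complex.exp (Complex.log z / 2)) (Complex.exp_ne_zero _), ?_,
    Units.ext (by simp), fun z => Units.ext ?_⟩
  · rw [Units.isEmbedding_val₀.continuousAt_iff]
    have : ContinuousAt (fun z : ℂˣ => Complex.log z) 1 :=
      ContinuousAt.clog Units.continuous_val.continuousAt (by simp [Complex.one_mem_slitPlane])
    exact (this.div_const 2).cexp
  · simp only [Units.val_pow_eq_pow_val, Units.val_mk0]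
    rw [← Complex.exp_nat_mul]
    push_cast
    rw [mul_div_cancel₀ _ two_ne_zero, Complex.exp_log z.ne_zero]

/-- The coordinatewise principal root `R` satisfies `(σ(R)/R)² = 1`, and this quotient is continuous
at `1` with value `1`. Its coordinates are signs that cannot be `-1` near the identity, so the root
is real there. -/
lemma exists_local_sqrt : ∃ r : T.G → T.G, ContinuousAt r 1 ∧ r 1 = 1 ∧
    ∀ᶠ g in 𝓝 1, r g ^ 2 = g := by
  classical
  obtain ⟨s, hs, hs1, hs2⟩ := exists_local_sqrt_units
  let R : T.GC → T.GC := fun z i => s (z i)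
  have hR1 : R 1 = 1 := funext fun _ => hs1
  have hR2 : ∀ z, R z ^ 2 = z := fun z => funext fun i => hs2 (z i)
  have hRc : ContinuousAt (fun g : T.G => R g) 1 := by
    refine continuousAt_pi.2 fun i => ?_
    have h1 : ContinuousAt (fun g : T.G => (g : T.GC) i) 1 :=
      ((continuous_apply i).comp continuous_subtype_val).continuousAt
    exact ContinuousAt.comp (f := fun g : T.G => (g : T.GC) i) (g := s) hs h1
  have hq : ContinuousAt (fun g : T.G => T.σ (R g) / R g) 1 := by
    have h2 : ContinuousAt (fun g : T.G => T.σ (R g)) 1 :=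
      T.continuous_σ.continuousAt.comp hRc
    exact h2.div' hRc
  have hev : ∀ᶠ g : T.G in 𝓝 1, T.σ (R g) = R g := by
    have h3 : ∀ i, ∀ᶠ g : T.G in 𝓝 1, ((((T.σ (R g) / R g) : T.GC) i : ℂˣ) : ℂ) ≠ -1 := by
      intro i
      have h4 : ContinuousAt (fun g : T.G => ((((T.σ (R g) / R g) : T.GC) i : ℂˣ) : ℂ)) 1 :=
        Units.continuous_val.continuousAt.comp (continuousAt_pi.1 hq i)
      refine h4.eventually_ne ?_
      simp only [OneMemClass.coe_one, hR1, map_one, div_one, Pi.one_apply, Units.val_one]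
      norm_num
    filter_upwards [eventually_all.2 h3] with g hg
    have h5 : (T.σ (R g) / R g) ^ 2 = 1 := by
      rw [div_pow, ← map_pow, hR2, T.mem_G.1 g.2, div_self']
    refine div_eq_one.1 (funext fun i => Units.ext ?_)
    have h6 : ((((T.σ (R g) / R g) : T.GC) i : ℂˣ) : ℂ) ^ 2 = 1 := by
      have := congrArg Units.val (congrFun h5 i)
      simpa only [Units.val_pow_eq_pow_val, Pi.pow_apply, Pi.one_apply, Units.val_one] using this
    exact (sq_eq_one_iff.1 h6).resolve_right (hg i)
  -- The default value `1` is never taken near the identity.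
  refine ⟨fun g => if h : T.σ (R g) = R g then ⟨R g, h⟩ else 1, ?_, ?_, ?_⟩
  · rw [Topology.IsEmbedding.subtypeVal.continuousAt_iff]
    refine hRc.congr ?_
    filter_upwards [hev] with g hg
    simp [hg]
  · refine Subtype.ext ?_
    simp [hR1]
  · filter_upwards [hev] with g hg
    refine Subtype.ext ?_
    simp [hg, hR2]

lemma continuous_exp : Continuous T.exp := by
  refine continuous_pi fun i => ?_
  rw [Units.isEmbedding_val₀.continuous_iff]
  exact Complex.continuous_exp.comp (continuous_apply i)

lemma continuous_expG : Continuous T.expG :=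
  (T.continuous_exp.comp continuous_subtype_val).subtype_mk _

lemma expG_add (X Y : T.lie) : T.expG (X + Y) = T.expG X * T.expG Y :=
  Subtype.ext (T.exp_add X Y)

lemma expG_zero : T.expG 0 = 1 := Subtype.ext T.exp_zero

lemma expG_half_sq (X : T.lie) : T.expG ((1 / 2 : ℝ) • X) ^ 2 = T.expG X := by
  rw [sq, ← expG_add, ← add_smul]
  norm_num

end RealTorus

/-! ### The centre of the two-fold cover. -/

namespace TwoFoldCover

variable {T : RealTorus} {Gt : Type u} [Group Gt] [TopologicalSpace Gt] [IsTopologicalGroup Gt]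
  (P : TwoFoldCover T Gt)

lemma ker_eq_of_ne_one {k k' : Gt} (hk : P.p k = 1) (hk' : P.p k' = 1) (h : k ≠ 1)
    (h' : k' ≠ 1) : k = k' := by
  obtain ⟨x, y, -, hxy⟩ := Nat.card_eq_two_iff.1 P.card_ker
  have key : ∀ z : P.p.ker, z = x ∨ z = y := fun z => by
    have : z ∈ ({x, y} : Set P.p.ker) := hxy ▸ Set.mem_univ z
    simpa using this
  have a := key ⟨k, hk⟩
  have b := key ⟨k', hk'⟩
  have c := key 1
  simp only [Subtype.ext_iff, OneMemClass.coe_one] at a b c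
  grind

lemma ker_sq {k : Gt} (hk : P.p k = 1) : k * k = 1 := by
  have h := pow_card_eq_one' (x := (⟨k, hk⟩ : P.p.ker))
  rw [P.card_ker, sq] at h
  exact congrArg Subtype.val h

/-- Conjugation preserves the kernel and its only nontrivial element. -/
lemma ker_mem_center {k : Gt} (hk : P.p k = 1) : k ∈ Subgroup.center Gt := by
  rw [Subgroup.mem_center_iff]
  intro g
  by_cases h : k = 1
  · simp [h]
  · rw [← mul_inv_eq_iff_eq_mul]
    refine P.ker_eq_of_ne_one (by simp [hk]) hk (fun h1 => h ?_) h
    rwa [mul_inv_eq_one, mul_eq_left] at h1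

lemma p_conj (y g : Gt) : P.p (y * g * y⁻¹ * g⁻¹) = 1 := by
  simp only [map_mul, map_inv]
  rw [mul_comm (P.p y), mul_inv_cancel_right, mul_inv_cancel]

/-- Moving `b` past `a` costs a central kernel element `k`; moving it past `a²` costs `k² = 1`. -/
lemma sq_mem_center (P : TwoFoldCover T Gt) (a : Gt) : a ^ 2 ∈ Subgroup.center Gt := by
  rw [Subgroup.mem_center_iff]
  intro b
  have hk := P.p_conj b a
  set k := b * a * b⁻¹ * a⁻¹ with hkdef
  have h1 : b * a = k * a * b := by rw [hkdef]; group
  have h2 := Subgroup.mem_center_iff.1 (P.ker_mem_center hk)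
  calc b * a ^ 2 = b * a * a := by rw [sq, mul_assoc]
    _ = k * a * (b * a) := by nth_rw 1 [h1]; simp only [mul_assoc]
    _ = k * (a * k) * a * b := by rw [h1]; simp only [mul_assoc]
    _ = (k * k) * a ^ 2 * b := by rw [h2 a, sq]; simp only [mul_assoc]
    _ = a ^ 2 * b := by rw [P.ker_sq hk, one_mul]

lemma p_mem_Z0 {g : Gt} : P.p g ∈ P.Z0 ↔ g ∈ Subgroup.center Gt := by
  refine ⟨?_, fun h => ⟨g, h, rfl⟩⟩
  rintro ⟨z, hz, hzg⟩
  have h1 : P.p (z⁻¹ * g) = 1 := by rw [map_mul, map_inv, hzg, inv_mul_cancel]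
  simpa using mul_mem hz (P.ker_mem_center h1)

lemma sq_mem_Z0 (g : T.G) : g ^ 2 ∈ P.Z0 := by
  obtain ⟨a, rfl⟩ := P.surjective g
  rw [← map_pow]
  exact P.p_mem_Z0.2 (P.sq_mem_center a)

/-- The element `k` is a nontrivial commutator. This is what forces genuine characters to vanish off
the centre. -/
lemma exists_conj_eq {g : Gt} (hg : g ∉ Subgroup.center Gt) :
    ∃ y k : Gt, P.p k = 1 ∧ k ≠ 1 ∧ y * g * y⁻¹ = k * g := by
  rw [Subgroup.mem_center_iff] at hg
  push Not at hg
  obtain ⟨y, hy⟩ := hg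
  refine ⟨y, y * g * y⁻¹ * g⁻¹, P.p_conj y g, fun h => hy ?_, by group⟩
  rwa [mul_inv_eq_one, mul_inv_eq_iff_eq_mul] at h

lemma finiteIndex_Z0 : P.Z0.FiniteIndex := by
  have := T.finite_quotient_squares
  have h : (powMonoidHom 2 : T.G →* T.G).range.FiniteIndex := Subgroup.finiteIndex_of_finite_quotient
  refine Subgroup.finiteIndex_of_le (H := (powMonoidHom 2 : T.G →* T.G).range) ?_
  rintro _ ⟨g, rfl⟩
  exact P.sq_mem_Z0 g

lemma index_Z0 : P.Z0.index = (Subgroup.center Gt).index :=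
  Subgroup.index_map_eq _ P.surjective fun _ hk => P.ker_mem_center hk

lemma finiteIndex_center (P : TwoFoldCover T Gt) : (Subgroup.center Gt).FiniteIndex :=
  ⟨by rw [← P.index_Z0]; exact P.finiteIndex_Z0.1⟩

lemma continuous_p : Continuous P.p := P.isCoveringMap.continuous

lemma exists_local_section : ∃ l : T.G → Gt, ContinuousAt l 1 ∧ l 1 = 1 ∧
    ∀ᶠ g in 𝓝 1, P.p (l g) = g := by
  obtain ⟨e, he, hpe⟩ := P.isCoveringMap.isLocalHomeomorph 1
  have h1 : e 1 = 1 := by rw [← hpe, map_one]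
  have ht : (1 : T.G) ∈ e.target := h1 ▸ e.map_source he
  refine ⟨e.symm, e.continuousAt_symm ht, ?_, ?_⟩
  · rw [← h1, e.left_inv he]
  · filter_upwards [e.open_target.mem_nhds ht] with g hg
    rw [hpe]
    exact e.right_inv hg

/-- Since both `p(Z(G̃))` and `φ(Ḡ)` contain the squares of `G`, this makes `Z(G̃)` and `S̃` open.
-/
lemma eventually_p_sq : ∀ᶠ g in 𝓝 (1 : Gt), ∃ r : T.G, r ^ 2 = P.p g := by
  obtain ⟨r, -, -, hr⟩ := T.exists_local_sqrt
  have h := P.continuous_p.continuousAt (x := 1)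
  rw [ContinuousAt, map_one] at h
  filter_upwards [h.eventually hr] with g hg
  exact ⟨_, hg⟩

lemma isOpen_center (P : TwoFoldCover T Gt) : IsOpen (Subgroup.center Gt : Set Gt) := by
  refine Subgroup.isOpen_of_mem_nhds _ (g := 1) ?_
  filter_upwards [P.eventually_p_sq] with g ⟨r, hr⟩
  exact P.p_mem_Z0.1 (hr ▸ P.sq_mem_Z0 r)


/-! ### The image of `φ` and the group `S̃`. -/

namespace TwoSubgroup

variable {P} (Q : TwoSubgroup P)

lemma φ_pbar (g : T.G) : Q.φ (Q.pbar g) = g ^ 2 := rfl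

lemma continuous_pbar : Continuous Q.pbar :=
  (QuotientGroup.continuous_mk.comp continuous_subtype_val).subtype_mk _

/-- For a representative `s` of a real point of the quotient, `z = σ(s)⁻¹ s` lies in `C`, and `s² =
(s σ(s)) z`. The norm is a square in `G`, hence in `p(Z(G̃))`, and `z` is there by hypothesis on
`C`. -/
lemma range_φ_le : Q.φ.range ≤ P.Z0 := by
  rintro _ ⟨⟨h, hh⟩, rfl⟩
  induction h using QuotientGroup.induction_on with
  | H s =>
    have h1 : ((T.σ s : T.GC) : Q.GbarC) = (s : Q.GbarC) := hh
    obtain ⟨z, hz, hzc⟩ := Q.le_Z0 (QuotientGroup.eq.1 h1)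
    obtain ⟨g, hg⟩ := T.exists_sq_eq_norm s
    have h2 : Q.φ ⟨(s : Q.GbarC), hh⟩ = g ^ 2 * z := by
      refine Subtype.ext ?_
      change s ^ 2 = (g : T.GC) ^ 2 * (z : T.GC)
      rw [show (z : T.GC) = (T.σ s)⁻¹ * s from hzc, hg, mul_assoc, mul_inv_cancel_left, sq]
    rw [h2]
    exact mul_mem (P.sq_mem_Z0 g) hz

lemma St_le_center : Q.St ≤ Subgroup.center Gt := fun _ hg => P.p_mem_Z0.1 (Q.range_φ_le hg)

lemma isOpen_St : IsOpen (Q.St : Set Gt) := by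
  refine Subgroup.isOpen_of_mem_nhds _ (g := 1) ?_
  filter_upwards [P.eventually_p_sq] with g ⟨r, hr⟩
  exact ⟨Q.pbar r, by rw [φ_pbar, hr]⟩

lemma ker_mem_St {k : Gt} (hk : P.p k = 1) : k ∈ Q.St := ⟨1, by rw [map_one, hk]⟩

lemma relIndex_St : Q.St.relIndex (Subgroup.center Gt) = Q.φ.range.relIndex P.Z0 :=
  Subgroup.relIndex_comap _ _ _

lemma finiteIndex_St : (Q.St.subgroupOf (Subgroup.center Gt)).FiniteIndex := by
  have := T.finite_quotient_squares
  have h : (powMonoidHom 2 : T.G →* T.G).range.FiniteIndex := Subgroup.finiteIndex_of_finite_quotient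
  have h1 : Q.φ.range.FiniteIndex := by
    refine Subgroup.finiteIndex_of_le (H := (powMonoidHom 2 : T.G →* T.G).range) ?_
    rintro _ ⟨g, rfl⟩
    exact ⟨Q.pbar g, rfl⟩
  have h2 : Q.St.FiniteIndex := by
    refine ⟨?_⟩
    rw [St, Subgroup.index_comap_of_surjective _ P.surjective]
    exact h1.1
  infer_instance

lemma finite_ker_φ : Finite Q.φ.ker := by
  have := (Q.X_finite 1).to_subtype
  refine Finite.of_injective (fun k : Q.φ.ker => (⟨k, ?_⟩ : Q.X 1)) fun a b h => ?_
  · rw [X, Set.mem_ofPred_eq, map_one]; exact k.2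
  · exact Subtype.ext (congrArg (fun t : Q.X 1 => (t : Q.Gbar)) h)

end TwoSubgroup

end TwoFoldCover

end

/-! ### Irreducible representations with a Heisenberg central character. -/

noncomputable section

namespace Representation

open Module

variable {G : Type*} [Group G] {V W : Type*} [AddCommGroup V] [Module ℂ V] [AddCommGroup W]
  [Module ℂ W]

section Irreducible

lemma isIrreducible_iff_forall_submodule (ρ : Representation ℂ G V) :
    ρ.IsIrreducible ↔ Nontrivial V ∧
      ∀ S : Submodule ℂ V, (∀ g, ∀ x ∈ S, ρ g x ∈ S) → S = ⊥ ∨ S = ⊤ := by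
  constructor
  · intro h
    refine ⟨?_, fun S hS => ?_⟩
    · by_contra hV
      rw [not_nontrivial_iff_subsingleton] at hV
      refine bot_ne_top (α := Subrepresentation ρ) ?_
      exact Subrepresentation.toSubmodule_injective (Subsingleton.elim _ _)
    · rcases eq_bot_or_eq_top (⟨S, fun g x hx => hS g x hx⟩ : Subrepresentation ρ) with h | h
      · exact Or.inl (congrArg Subrepresentation.toSubmodule h)
      · exact Or.inr (congrArg Subrepresentation.toSubmodule h)
  · rintro ⟨hV, h⟩
    have hn : Nontrivial (Subrepresentation ρ) :=
      ⟨⊥, ⊤, fun hbt => bot_ne_top (α := Submodule ℂ V)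
        (congrArg Subrepresentation.toSubmodule hbt)⟩
    refine { hn with eq_bot_or_eq_top := fun S => ?_ }
    rcases h S.toSubmodule fun g x hx => S.apply_mem_toSubmodule g hx with h | h
    · exact Or.inl (Subrepresentation.toSubmodule_injective h)
    · exact Or.inr (Subrepresentation.toSubmodule_injective h)

lemma Equiv.isIrreducible {ρ : Representation ℂ G V} {σ : Representation ℂ G W} (e : ρ.Equiv σ)
    (h : ρ.IsIrreducible) : σ.IsIrreducible := by
  rw [isIrreducible_iff_forall_submodule] at h ⊢
  obtain ⟨hV, h⟩ := h
  refine ⟨e.toLinearEquiv.symm.toEquiv.nontrivial, fun S hS => ?_⟩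
  have hc : S = (S.comap e.toLinearEquiv.toLinearMap).map e.toLinearEquiv.toLinearMap :=
    (Submodule.map_comap_eq_of_surjective e.toLinearEquiv.surjective S).symm
  have hst : ∀ g, ∀ x ∈ S.comap e.toLinearEquiv.toLinearMap,
      ρ g x ∈ S.comap e.toLinearEquiv.toLinearMap := by
    intro g x hx
    have := IntertwiningMap.isIntertwining _ _ e.toIntertwiningMap g x
    exact Submodule.mem_comap.2
      ((this : e.toLinearEquiv (ρ g x) = σ g (e.toLinearEquiv x)) ▸ hS g _ hx)
  rcases h _ hst with h | h
  · left; rw [hc, h, Submodule.map_bot]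
  · right; rw [hc, h, Submodule.map_top, LinearEquiv.range]

/-- Finite dimension makes the lattice of subrepresentations well-founded, hence atomic; an atom is
irreducible. -/
lemma exists_isIrreducible_le [FiniteDimensional ℂ V] (ρ : Representation ℂ G V)
    (S : Submodule ℂ V) (hS : ∀ g, ∀ x ∈ S, ρ g x ∈ S) (hS0 : S ≠ ⊥) :
    ∃ A : Subrepresentation ρ, A.toSubmodule ≤ S ∧ A.toRepresentation.IsIrreducible := by
  have hmono : StrictMono (Subrepresentation.toSubmodule : Subrepresentation ρ → Submodule ℂ V) :=
    fun _ _ h => h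
  have hwf : WellFoundedLT (Subrepresentation ρ) := hmono.wellFoundedLT
  have hat : IsAtomic (Subrepresentation ρ) := inferInstance
  obtain ⟨A, hA, hAS⟩ := (hat.eq_bot_or_exists_atom_le ⟨S, fun g x hx => hS g x hx⟩).resolve_left
    fun h => hS0 (congrArg Subrepresentation.toSubmodule h)
  refine ⟨A, hAS, (isIrreducible_iff_forall_submodule _).2 ⟨?_, fun B hB => ?_⟩⟩
  · rw [Submodule.nontrivial_iff_ne_bot]
    exact fun h => hA.1 (Subrepresentation.toSubmodule_injective h)
  · let B' : Subrepresentation ρ := ⟨B.map A.toSubmodule.subtype, by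
      rintro g _ ⟨x, hx, rfl⟩
      exact ⟨_, hB g x hx, rfl⟩⟩
    have hle : B' ≤ A := by
      rintro _ ⟨x, -, rfl⟩
      exact x.2
    rcases hA.le_iff.1 hle with h | h
    · left
      have : B.map A.toSubmodule.subtype = ⊥ := congrArg Subrepresentation.toSubmodule h
      exact Submodule.map_injective_of_injective A.toSubmodule.injective_subtype
        (this.trans (Submodule.map_bot _).symm)
    · right
      have : B.map A.toSubmodule.subtype = A.toSubmodule :=
        congrArg Subrepresentation.toSubmodule h
      exact Submodule.map_injective_of_injective A.toSubmodule.injective_subtype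
        (this.trans (Submodule.map_subtype_top _).symm)

end Irreducible

/-- The centre of the group acts through the character `ψ`. -/
def HasCentralChar (ρ : Representation ℂ G V) (ψ : Subgroup.center G →* ℂˣ) : Prop :=
  ∀ (z : Subgroup.center G) (x : V), ρ z x = ((ψ z : ℂˣ) : ℂ) • x

/-- A character of the centre for which every non-central element is conjugate to a central
multiple of itself on which the character detects the difference. -/
def IsHeisenberg (ψ : Subgroup.center G →* ℂˣ) : Prop :=
  ∀ g ∉ Subgroup.center G, ∃ (y : G) (z : Subgroup.center G), y * g * y⁻¹ = z * g ∧ ψ z ≠ 1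

lemma HasCentralChar.toRepresentation {ρ : Representation ℂ G V}
    {ψ : Subgroup.center G →* ℂˣ} (h : ρ.HasCentralChar ψ) (A : Subrepresentation ρ) :
    A.toRepresentation.HasCentralChar ψ :=
  fun z x => Subtype.ext (h z x)

lemma trace_conj_eq (ρ : Representation ℂ G V) (y g : G) :
    LinearMap.trace ℂ V (ρ (y * g * y⁻¹)) = LinearMap.trace ℂ V (ρ g) := by
  rw [map_mul, LinearMap.trace_mul_comm, ← map_mul]
  congr 2
  group

namespace HasCentralChar

variable {ρ : Representation ℂ G V} {σ : Representation ℂ G W} {ψ : Subgroup.center G →* ℂˣ}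

/-- Conjugating `g` preserves the trace but also multiplies it by `ψ z ≠ 1`. -/
lemma trace_eq_zero (h : ρ.HasCentralChar ψ) (hψ : IsHeisenberg ψ) {g : G}
    (hg : g ∉ Subgroup.center G) : LinearMap.trace ℂ V (ρ g) = 0 := by
  obtain ⟨y, z, hy, hz⟩ := hψ g hg
  have h1 := ρ.trace_conj_eq y g
  have h2 : ρ (z * g) = ((ψ z : ℂˣ) : ℂ) • ρ g := by
    ext x
    rw [map_mul]
    exact h z _
  rw [hy, h2, map_smul, smul_eq_mul] at h1
  by_contra h0
  exact hz (Units.ext ((mul_eq_right₀ h0).1 h1))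

lemma trace_center [FiniteDimensional ℂ V] (h : ρ.HasCentralChar ψ) (z : Subgroup.center G) :
    LinearMap.trace ℂ V (ρ z) = ((ψ z : ℂˣ) : ℂ) * finrank ℂ V := by
  have h2 : ρ z = ((ψ z : ℂˣ) : ℂ) • LinearMap.id := by
    ext x
    exact h z x
  rw [h2, map_smul, LinearMap.trace_id, smul_eq_mul]

/-- The conjugate of a linear map by an element of the group. -/
def conjTerm (ρ : Representation ℂ G V) (σ : Representation ℂ G W) (f : V →ₗ[ℂ] W) (x : G) :
    V →ₗ[ℂ] W :=
  σ x ∘ₗ f ∘ₗ ρ x⁻¹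

/-- The scalars `ψ z` and `(ψ z)⁻¹` cancel, so averaging over cosets does not depend on the
representatives. -/
lemma conjTerm_mul_center (h : ρ.HasCentralChar ψ) (h' : σ.HasCentralChar ψ) (f : V →ₗ[ℂ] W)
    (x : G) (z : Subgroup.center G) : conjTerm ρ σ f (x * z) = conjTerm ρ σ f x := by
  ext v
  have h1 : ρ ((z : G)⁻¹) (ρ x⁻¹ v) = (((ψ z)⁻¹ : ℂˣ) : ℂ) • ρ x⁻¹ v := by
    rw [← map_inv]; exact h z⁻¹ _
  simp only [conjTerm, LinearMap.comp_apply, map_mul, mul_inv_rev, Module.End.mul_apply, h1,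
    map_smul, h' z, smul_smul]
  simp

variable [(Subgroup.center G).FiniteIndex]

/-- The average of a linear map over the group modulo its centre. -/
def average (ρ : Representation ℂ G V) (σ : Representation ℂ G W) (f : V →ₗ[ℂ] W) : V →ₗ[ℂ] W :=
  letI := Fintype.ofFinite (G ⧸ Subgroup.center G)
  ∑ q : G ⧸ Subgroup.center G, conjTerm ρ σ f q.out

lemma average_intertwines (h : ρ.HasCentralChar ψ) (h' : σ.HasCentralChar ψ) (f : V →ₗ[ℂ] W)
    (g : G) : average ρ σ f ∘ₗ ρ g = σ g ∘ₗ average ρ σ f := by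
  let _ := Fintype.ofFinite (G ⧸ Subgroup.center G)
  have key : ∀ q : G ⧸ Subgroup.center G,
      conjTerm ρ σ f (g • q).out ∘ₗ ρ g = σ g ∘ₗ conjTerm ρ σ f q.out := by
    intro q
    have h1 : ((g * q.out : G) : G ⧸ Subgroup.center G) = ((g • q).out : G) := by
      rw [QuotientGroup.out_eq']
      conv_rhs => rw [← QuotientGroup.out_eq' q]
      rfl
    have h2 : (g • q).out = g * q.out * (⟨_, QuotientGroup.eq.1 h1⟩ : Subgroup.center G) := by
      group
    rw [h2, conjTerm_mul_center h h']
    ext v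
    simp only [conjTerm, LinearMap.comp_apply, map_mul, mul_inv_rev, Module.End.mul_apply]
    rw [← Module.End.mul_apply (ρ g⁻¹), ← map_mul, inv_mul_cancel, map_one, Module.End.one_apply]
  ext v
  simp only [average, LinearMap.comp_apply, LinearMap.sum_apply, map_sum]
  rw [← Equiv.sum_comp (MulAction.toPerm g)]
  exact Finset.sum_congr rfl fun q _ => LinearMap.congr_fun (key q) v

lemma trace_average (f : V →ₗ[ℂ] V) :
    LinearMap.trace ℂ V (average ρ ρ f) = (Subgroup.center G).index * LinearMap.trace ℂ V f := by
  let _ := Fintype.ofFinite (G ⧸ Subgroup.center G)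
  have key : ∀ x, LinearMap.trace ℂ V (conjTerm ρ ρ f x) = LinearMap.trace ℂ V f := by
    intro x
    change LinearMap.trace ℂ V (ρ x * (f * ρ x⁻¹)) = _
    rw [LinearMap.trace_mul_comm, mul_assoc, ← map_mul, inv_mul_cancel, map_one, mul_one]
  rw [average, map_sum, Finset.sum_congr rfl fun q _ => key _, Finset.sum_const, Finset.card_univ,
    Subgroup.index_eq_card, Nat.card_eq_fintype_card, nsmul_eq_mul]

/-- Summed over elementary maps, the average becomes `∑ tr ρ(q⁻¹) tr σ(q)` over cosets `q` of the
centre; only the trivial coset contributes. -/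
lemma sum_average {ι κ : Type*} [Fintype ι] [Fintype κ] (b : Basis ι ℂ V) (b' : Basis κ ℂ W)
    (h : ρ.HasCentralChar ψ) (h' : σ.HasCentralChar ψ) (hψ : IsHeisenberg ψ) :
    ∑ i, ∑ j, b'.coord j (average ρ σ ((b.coord i).smulRight (b' j)) (b i)) =
      finrank ℂ V * finrank ℂ W := by
  let _ := Fintype.ofFinite (G ⧸ Subgroup.center G)
  classical
  have := b.finiteDimensional_of_finite
  have := b'.finiteDimensional_of_finite
  have htr : ∀ x, ∑ i, ∑ j, b'.coord j (conjTerm ρ σ ((b.coord i).smulRight (b' j)) x (b i)) =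
      LinearMap.trace ℂ V (ρ x⁻¹) * LinearMap.trace ℂ W (σ x) := by
    intro x
    rw [LinearMap.trace_eq_matrix_trace ℂ b, LinearMap.trace_eq_matrix_trace ℂ b', Matrix.trace,
      Matrix.trace, Finset.sum_mul_sum]
    refine Finset.sum_congr rfl fun i _ => Finset.sum_congr rfl fun j _ => ?_
    simp [conjTerm, LinearMap.toMatrix_apply]
  have hswap : ∑ i, ∑ j, b'.coord j (average ρ σ ((b.coord i).smulRight (b' j)) (b i)) =
      ∑ q : G ⧸ Subgroup.center G,
        LinearMap.trace ℂ V (ρ q.out⁻¹) * LinearMap.trace ℂ W (σ q.out) := by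
    simp_rw [← htr, average, LinearMap.sum_apply, map_sum]
    rw [Finset.sum_comm]
    refine (Finset.sum_congr rfl fun j _ => Finset.sum_comm).trans ?_
    rw [Finset.sum_comm]
    exact Finset.sum_congr rfl fun q _ => Finset.sum_comm
  rw [hswap, Finset.sum_eq_single (1 : G ⧸ Subgroup.center G)]
  · have h1 : ((1 : G ⧸ Subgroup.center G).out : G) ∈ Subgroup.center G := by
      rw [← QuotientGroup.eq_one_iff, QuotientGroup.out_eq']
    generalize (1 : G ⧸ Subgroup.center G).out = x at h1
    lift x to Subgroup.center G using h1
    rw [h'.trace_center, ← Subgroup.coe_inv, h.trace_center, map_inv, mul_mul_mul_comm]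
    simp
  · intro q _ hq
    have h1 : (q.out : G) ∉ Subgroup.center G := by
      rwa [← QuotientGroup.eq_one_iff, QuotientGroup.out_eq']
    rw [h'.trace_eq_zero hψ h1, mul_zero]
  · simp

/-- Without an isomorphism Schur's lemma kills every average, yet their sum in `sum_average` is a
product of positive dimensions. -/
lemma nonempty_equiv [FiniteDimensional ℂ V] [FiniteDimensional ℂ W] (h : ρ.HasCentralChar ψ)
    (h' : σ.HasCentralChar ψ) (hψ : IsHeisenberg ψ) (hρ : ρ.IsIrreducible)
    (hσ : σ.IsIrreducible) : Nonempty (ρ.Equiv σ) := by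
  have hV := ((isIrreducible_iff_forall_submodule ρ).1 hρ).1
  have hW := ((isIrreducible_iff_forall_submodule σ).1 hσ).1
  by_contra hne
  have h0 : ∀ f, average ρ σ f = 0 := by
    intro f
    let F : IntertwiningMap ρ σ := ⟨average ρ σ f, average_intertwines h h' f⟩
    rcases IsIrreducible.bijective_or_eq_zero F with hb | hz
    · exact (hne ⟨F.ofBijective hb⟩).elim
    · exact congrArg IntertwiningMap.toLinearMap hz
  have h1 := sum_average (finBasis ℂ V) (finBasis ℂ W) h h' hψ
  simp only [h0, LinearMap.zero_apply, map_zero, Finset.sum_const_zero] at h1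
  have := (finrank_pos (R := ℂ) (M := V)).ne'
  have := (finrank_pos (R := ℂ) (M := W)).ne'
  simp_all

/-- By Schur the average of `f` is a scalar `c f`, and traces give `c f · dim V = |G/Z| · tr f`. In
`sum_average` only the diagonal elementary maps, of trace `1`, contribute. -/
lemma finrank_sq [FiniteDimensional ℂ V] (h : ρ.HasCentralChar ψ) (hψ : IsHeisenberg ψ)
    (hρ : ρ.IsIrreducible) : finrank ℂ V ^ 2 = (Subgroup.center G).index := by
  have hV := ((isIrreducible_iff_forall_submodule ρ).1 hρ).1
  have h0 : ∀ f, ∃ c : ℂ, average ρ ρ f = c • LinearMap.id := by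
    intro f
    let F : IntertwiningMap ρ ρ := ⟨average ρ ρ f, average_intertwines h h f⟩
    obtain ⟨c, hc⟩ := IsIrreducible.algebraMap_intertwiningMap_bijective_of_isAlgClosed.2 F
    refine ⟨c, ?_⟩
    rw [show average ρ ρ f = F.toLinearMap from rfl, ← hc]
    rfl
  choose c hc using h0
  have htr : ∀ f, c f * finrank ℂ V = (Subgroup.center G).index * LinearMap.trace ℂ V f := by
    intro f
    rw [← trace_average (ρ := ρ), hc, map_smul, LinearMap.trace_id, smul_eq_mul]
  have h1 := sum_average (finBasis ℂ V) (finBasis ℂ V) h h hψ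
  have hd : (finrank ℂ V : ℂ) ≠ 0 := by
    exact_mod_cast (finrank_pos (R := ℂ) (M := V)).ne'
  have h2 : (finrank ℂ V : ℂ) * (finrank ℂ V * finrank ℂ V) =
      finrank ℂ V * (Subgroup.center G).index := by
    rw [← h1, Finset.mul_sum]
    have : ∀ i : Fin (finrank ℂ V), (finrank ℂ V : ℂ) * ∑ j, (finBasis ℂ V).coord j
        (average ρ ρ (((finBasis ℂ V).coord i).smulRight (finBasis ℂ V j)) (finBasis ℂ V i)) =
        (Subgroup.center G).index := by
      intro i
      rw [Finset.sum_eq_single i]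
      · rw [hc]
        simp only [LinearMap.smul_apply, LinearMap.id_apply, map_smul, Basis.coord_apply,
          Basis.repr_self, Finsupp.single_eq_same, smul_eq_mul, mul_one]
        rw [mul_comm, htr, LinearMap.trace_smulRight]
        simp
      · intro j _ hj
        rw [hc]
        simp [Finsupp.single_eq_of_ne hj]
      · simp
    rw [Finset.sum_congr rfl fun i _ => this i]
    simp
  have h3 := mul_left_cancel₀ hd h2
  rw [sq]
  exact_mod_cast h3

/-- An irreducible subrepresentation of any nonzero stable subspace already has the full dimension.
-/
lemma isIrreducible_of_finrank [FiniteDimensional ℂ V] (h : ρ.HasCentralChar ψ)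
    (hψ : IsHeisenberg ψ) (hd : finrank ℂ V ^ 2 = (Subgroup.center G).index) :
    ρ.IsIrreducible := by
  refine (isIrreducible_iff_forall_submodule ρ).2 ⟨?_, fun S hS => or_iff_not_imp_left.2 fun h0 => ?_⟩
  · refine nontrivial_of_finrank_pos (R := ℂ) (Nat.pos_of_ne_zero fun h0 => ?_)
    rw [h0] at hd
    exact Subgroup.FiniteIndex.index_ne_zero (H := Subgroup.center G) (by rw [← hd]; rfl)
  · obtain ⟨A, hAS, hA⟩ := ρ.exists_isIrreducible_le S hS h0
    have h1 := finrank_sq (h.toRepresentation A) hψ hA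
    rw [← hd] at h1
    have h2 := Nat.pow_left_injective two_ne_zero h1
    exact top_le_iff.1 ((Submodule.eq_top_of_finrank_eq h2).ge.trans hAS)

end HasCentralChar

/-- The irreducible piece is transported to a coordinate space in order to land in a prescribed
universe. -/
lemma HasCentralChar.exists_isIrreducible_ulift [FiniteDimensional ℂ V] [Nontrivial V]
    {ρ : Representation ℂ G V} {ψ : Subgroup.center G →* ℂˣ} (h : ρ.HasCentralChar ψ) :
    ∃ (n : ℕ) (ρ : Representation ℂ G (ULift.{v} (Fin n → ℂ))),
      ρ.IsIrreducible ∧ ρ.HasCentralChar ψ := by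
  obtain ⟨A, -, hA⟩ := ρ.exists_isIrreducible_le ⊤ (fun _ _ _ => Submodule.mem_top) top_ne_bot
  have hAc := h.toRepresentation A
  let e : A.toSubmodule ≃ₗ[ℂ] ULift.{v} (Fin (finrank ℂ A.toSubmodule) → ℂ) :=
    (finBasis ℂ A.toSubmodule).equivFun.trans ULift.moduleEquiv.symm
  let ρ' : Representation ℂ G (ULift.{v} (Fin (finrank ℂ A.toSubmodule) → ℂ)) :=
    { toFun := fun g => e.conj (A.toRepresentation g)
      map_one' := by rw [map_one]; exact e.conj_id
      map_mul' := fun g g' => by rw [map_mul]; exact e.conj_comp _ _ }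
  refine ⟨_, ρ', ?_, fun z x => ?_⟩
  · refine Equiv.isIrreducible (Equiv.mk e fun g => LinearMap.ext fun x => ?_) hA
    change _ = e (A.toRepresentation g (e.symm (e x)))
    rw [e.symm_apply_apply]
    rfl
  · change e (A.toRepresentation z (e.symm x)) = _
    rw [hAc, map_smul, e.apply_symm_apply]

section Existence

variable (ψ : Subgroup.center G →* ℂˣ)

/-- The functions on the group that transform by `ψ` under translation by the centre. -/
def equivariantFunctions : Submodule ℂ (G → ℂ) where
  carrier := {f | ∀ (z : Subgroup.center G) (g : G), f (z * g) = ((ψ z : ℂˣ) : ℂ) * f g}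
  add_mem' ha hb z g := by simp only [Pi.add_apply, ha z g, hb z g, mul_add]
  zero_mem' z g := by simp
  smul_mem' c f hf z g := by simp only [Pi.smul_apply, hf z g, smul_eq_mul]; ring

/-- The representation by right translations on the functions that transform by `ψ`. -/
def translation : Representation ℂ G (equivariantFunctions ψ) where
  toFun x :=
    { toFun := fun f => ⟨fun g => f.1 (g * x), fun z g => by simpa only [mul_assoc] using f.2 z (g * x)⟩
      map_add' := fun _ _ => rfl
      map_smul' := fun _ _ => rfl }
  map_one' := by
    ext f g
    exact congrArg f.1 (mul_one g)
  map_mul' x y := by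
    ext f g
    exact congrArg f.1 (mul_assoc g x y).symm

lemma translation_hasCentralChar : (translation ψ).HasCentralChar ψ := by
  intro z f
  ext g
  change f.1 (g * z) = _
  rw [Subgroup.mem_center_iff.1 z.2 g]
  exact f.2 z g

lemma finiteDimensional_equivariantFunctions [(Subgroup.center G).FiniteIndex] :
    FiniteDimensional ℂ (equivariantFunctions ψ) := by
  let L : equivariantFunctions ψ →ₗ[ℂ] (G ⧸ Subgroup.center G → ℂ) :=
    { toFun := fun f q => f.1 q.out
      map_add' := fun _ _ => rfl
      map_smul' := fun _ _ => rfl }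
  refine FiniteDimensional.of_injective L fun f f' hff => Subtype.ext (funext fun g => ?_)
  have h1 : (((g : G ⧸ Subgroup.center G).out : G) : G ⧸ Subgroup.center G) = g :=
    QuotientGroup.out_eq' _
  have h2 : g = (⟨_, QuotientGroup.eq.1 h1⟩ : Subgroup.center G) *
      (g : G ⧸ Subgroup.center G).out := by
    rw [← Subgroup.mem_center_iff.1 (⟨_, QuotientGroup.eq.1 h1⟩ : Subgroup.center G).2]
    simp
  rw [h2, f.2, f'.2]
  exact congrArg _ (congrFun hff (g : G ⧸ Subgroup.center G))

/-- Extending `ψ` by zero off the centre gives a nonzero element. -/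
lemma nontrivial_equivariantFunctions : Nontrivial (equivariantFunctions ψ) := by
  classical
  refine ⟨⟨fun g => if hg : g ∈ Subgroup.center G then ((ψ ⟨g, hg⟩ : ℂˣ) : ℂ) else 0, ?_⟩, 0, ?_⟩
  · intro z g
    by_cases hg : g ∈ Subgroup.center G
    · have hzg : (z : G) * g ∈ Subgroup.center G := mul_mem z.2 hg
      simp only [hg, hzg, dif_pos]
      rw [← Units.val_mul, ← map_mul]
      rfl
    · have hzg : (z : G) * g ∉ Subgroup.center G := by
        rwa [Subgroup.mul_mem_cancel_left _ z.2]
      simp [hg, hzg]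
  · intro h
    have := congrFun (congrArg Subtype.val h) 1
    simp [one_mem] at this

lemma exists_isIrreducible_hasCentralChar [(Subgroup.center G).FiniteIndex] :
    ∃ (n : ℕ) (ρ : Representation ℂ G (ULift.{v} (Fin n → ℂ))),
      ρ.IsIrreducible ∧ ρ.HasCentralChar ψ := by
  have := finiteDimensional_equivariantFunctions ψ
  have := nontrivial_equivariantFunctions ψ
  exact (translation_hasCentralChar ψ).exists_isIrreducible_ulift

end Existence

end Representation

end

noncomputable section

open Filter Topology

/-! ### Extending characters from a subgroup of finite index. -/

section Extension

variable {A : Type*} [CommGroup A]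

/-- The group `ℂˣ` is divisible, hence injective among abelian groups by Baer's criterion. -/
lemma MonoidHom.exists_extension_units (B : Subgroup A) (f : B →* ℂˣ) :
    ∃ F : A →* ℂˣ, ∀ b : B, F b = f b := by
  have hroot : ∀ (n : ℤ), n ≠ 0 → ∀ x : Additive ℂˣ, ∃ y : Additive ℂˣ, n • y = x := by
    intro n hn x
    obtain ⟨w, hw⟩ := IsAlgClosed.exists_pow_nat_eq ((Additive.toMul x : ℂˣ) : ℂ)
      (Int.natAbs_pos.2 hn)
    have hw0 : w ≠ 0 := by
      rintro rfl
      rw [zero_pow (Int.natAbs_ne_zero.2 hn)] at hw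
      exact (Additive.toMul x).ne_zero hw.symm
    have h1 : (Units.mk0 w hw0) ^ n.natAbs = Additive.toMul x := Units.ext (by simpa using hw)
    rcases Int.natAbs_eq n with h | h
    · refine ⟨Additive.ofMul (Units.mk0 w hw0), ?_⟩
      rw [h, natCast_zsmul]
      exact congrArg Additive.ofMul h1
    · refine ⟨-Additive.ofMul (Units.mk0 w hw0), ?_⟩
      rw [h, zsmul_neg, neg_zsmul, neg_neg, natCast_zsmul]
      exact congrArg Additive.ofMul h1
  let _ : DivisibleBy (Additive ℂˣ) ℤ := divisibleByOfSMulRightSurj _ _ fun {n} hn x => hroot n hn x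
  have hB := Module.Baer.of_divisible (Additive ℂˣ)
  obtain ⟨F, hF⟩ := hB.extension_property_addMonoidHom (B.subtype.toAdditive)
    (fun a b h => Subtype.val_injective h) f.toAdditive
  exact ⟨AddMonoidHom.toMultiplicative F, fun b => DFunLike.congr_fun hF b⟩

lemma MonoidHom.exists_apply_ne_one_of_notMem (B : Subgroup A) [B.FiniteIndex] {a : A}
    (ha : a ∉ B) : ∃ θ : A →* ℂˣ, (∀ b ∈ B, θ b = 1) ∧ θ a ≠ 1 := by
  have h1 : (QuotientGroup.mk a : A ⧸ B) ≠ 1 := by rwa [Ne, QuotientGroup.eq_one_iff]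
  obtain ⟨θ, hθ⟩ := CommGroup.exists_apply_ne_one_of_hasEnoughRootsOfUnity (A ⧸ B) ℂ h1
  refine ⟨θ.comp (QuotientGroup.mk' B), fun b hb => ?_, hθ⟩
  rw [MonoidHom.comp_apply, QuotientGroup.mk'_apply, (QuotientGroup.eq_one_iff b).2 hb, map_one]

/-- The extensions of a character of a subgroup are a torsor under the dual of the quotient. -/
def extensionEquiv (B : Subgroup A) (f : B →* ℂˣ) (F₀ : {F : A →* ℂˣ // ∀ b : B, F b = f b}) :
    (A ⧸ B →* ℂˣ) ≃ {F : A →* ℂˣ // ∀ b : B, F b = f b} where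
  toFun θ := ⟨F₀.1 * θ.comp (QuotientGroup.mk' B), fun b => by
    rw [MonoidHom.mul_apply, F₀.2, MonoidHom.comp_apply, QuotientGroup.mk'_apply,
      (QuotientGroup.eq_one_iff (b : A)).2 b.2, map_one, mul_one]⟩
  invFun F := QuotientGroup.lift B (F.1 / F₀.1) fun b hb => by
    rw [MonoidHom.mem_ker, MonoidHom.div_apply, F.2 ⟨b, hb⟩, F₀.2 ⟨b, hb⟩, div_self']
  left_inv θ := by
    ext a
    simp
  right_inv F := by
    ext a
    simp

lemma card_extensions (B : Subgroup A) [B.FiniteIndex] (f : B →* ℂˣ) :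
    Nat.card {F : A →* ℂˣ // ∀ b : B, F b = f b} = B.index := by
  obtain ⟨F₀, hF₀⟩ := MonoidHom.exists_extension_units B f
  rw [← Nat.card_congr (extensionEquiv B f ⟨F₀, hF₀⟩),
    CommGroup.card_monoidHom_of_hasEnoughRootsOfUnity, Subgroup.index_eq_card]

lemma finite_extensions (B : Subgroup A) [B.FiniteIndex] (f : B →* ℂˣ) :
    Finite {F : A →* ℂˣ // ∀ b : B, F b = f b} :=
  Nat.finite_of_card_ne_zero (by rw [card_extensions]; exact Subgroup.FiniteIndex.index_ne_zero)

end Extension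

open scoped IsMulCommutative

/-! ### The character `ψ̃₀`, its extensions, and the values of the lift. -/

namespace TwoFoldCover

variable {T : RealTorus} {Gt : Type u} [Group Gt] [TopologicalSpace Gt] [IsTopologicalGroup Gt]
  {P : TwoFoldCover T Gt}

lemma GenuineChar.isHeisenberg (ψt : P.GenuineChar) :
    Representation.IsHeisenberg (ψt.1 : Subgroup.center Gt →* ℂˣ) := by
  intro g hg
  obtain ⟨y, k, hk, hk1, hy⟩ := P.exists_conj_eq hg
  refine ⟨y, ⟨k, P.ker_mem_center hk⟩, hy, ?_⟩
  have h := ψt.2 ⟨k, P.ker_mem_center hk⟩ hk fun h => hk1 (congrArg Subtype.val h)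
  rw [show (ψt.1 : Subgroup.center Gt →* ℂˣ) ⟨k, P.ker_mem_center hk⟩ = -1 from h]
  intro h1
  have := congrArg Units.val h1
  norm_num at this

namespace TwoSubgroup

variable (Q : TwoSubgroup P)

/-- The character `ψ χ⁻¹` is trivial on `Ker φ`, so it descends to `φ(Ḡ)` and any choice of
preimages gives a homomorphism. -/
lemma exists_psi0 (χt : P.GenuineChar) (χ ψ : Q.Gbar →ₜ* ℂˣ) (h : ∀ t ∈ Q.φ.ker, χ t = ψ t) :
    ∃ ψ₀ : Q.St →ₜ* ℂˣ, Q.IsPsi0 Q.St_le_center χt χ ψ ψ₀ := by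
  have hwd : ∀ a b : Q.Gbar, Q.φ a = Q.φ b → ψ a * (χ a)⁻¹ = ψ b * (χ b)⁻¹ := by
    intro a b hab
    have h1 : a / b ∈ Q.φ.ker := by rw [MonoidHom.mem_ker, map_div, hab, div_self']
    have h2 := h _ h1
    rw [map_div, map_div, div_eq_div_iff_mul_eq_mul] at h2
    rw [← div_eq_mul_inv, ← div_eq_mul_inv, div_eq_div_iff_mul_eq_mul, ← h2, mul_comm]
  have hc : ∀ s : Q.St, ∃ a : Q.Gbar, Q.φ a = P.p s := fun s => s.2
  choose a ha using hc
  let f : Q.St →* ℂˣ :=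
    { toFun := fun s => χt.1 ⟨s, Q.St_le_center s.2⟩ * (ψ (a s) * (χ (a s))⁻¹)
      map_one' := by
        rw [hwd (a 1) 1 (by rw [ha, map_one]; exact map_one _), map_one, map_one, inv_one, mul_one,
          mul_one]
        exact map_one χt.1
      map_mul' := fun s t => by
        rw [hwd (a (s * t)) (a s * a t)
          (by rw [ha, map_mul, ha, ha]; exact map_mul _ _ _), map_mul, map_mul, mul_inv,
          mul_mul_mul_comm (ψ (a s)), mul_mul_mul_comm (χt.1 _), ← map_mul]
        rfl }
  have hf : ∀ (s : Q.St), ∀ b ∈ Q.X (s : Gt), f s = χt.1 ⟨s, Q.St_le_center s.2⟩ * ψ b * (χ b)⁻¹ := by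
    intro s b hb
    rw [mul_assoc, ← hwd (a s) b ((ha s).trans hb.symm)]
    rfl
  have hcont : Continuous f := by
    refine continuous_of_continuousAt_one f ?_
    obtain ⟨r, hrc, hr1, hr⟩ := T.exists_local_sqrt
    have hp : Tendsto (fun s : Q.St => P.p s) (𝓝 1) (𝓝 1) := by
      have := (P.continuous_p.comp (continuous_subtype_val (p := (· ∈ Q.St)))).continuousAt (x := 1)
      simpa [ContinuousAt, Function.comp_def] using this
    -- The chosen preimages `a s` need not vary continuously; near `1` the local square root of
    -- `p(s)` supplies preimages that do, with the same value of `f`.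
    have hpr : ContinuousAt (fun s : Q.St => Q.pbar (r (P.p s))) 1 := by
      refine Q.continuous_pbar.continuousAt.comp (f := fun s : Q.St => r (P.p s)) ?_
      have := hrc.tendsto.comp hp
      simpa [ContinuousAt, hr1, Function.comp_def] using this
    have hχt : Continuous fun s : Q.St => χt.1 ⟨s, Q.St_le_center s.2⟩ :=
      χt.1.continuous_toFun.comp (continuous_subtype_val.subtype_mk _)
    have hg : ContinuousAt (fun s : Q.St => χt.1 ⟨s, Q.St_le_center s.2⟩ *
        ψ (Q.pbar (r (P.p s))) * (χ (Q.pbar (r (P.p s))))⁻¹) 1 :=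
      (hχt.continuousAt.mul (ψ.continuous_toFun.continuousAt.comp hpr)).mul
        (χ.continuous_toFun.continuousAt.comp hpr).inv
    refine hg.congr ?_
    filter_upwards [hp.eventually hr] with s hs
    exact (hf s _ (by rw [X, Set.mem_ofPred_eq, φ_pbar, hs])).symm
  refine ⟨⟨f, hcont⟩, fun s hs hs1 => ?_, hf⟩
  have h1 := hf s 1 (by rw [X, Set.mem_ofPred_eq, map_one, hs])
  rw [map_one, map_one, inv_one, mul_one, mul_one] at h1
  exact h1.trans (χt.2 ⟨s, Q.St_le_center s.2⟩ hs fun h => hs1 (Subtype.ext (congrArg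
    (fun z : Subgroup.center Gt => (z : Gt)) h)))

variable {Q}

/-- Restriction of a character of `S̃` to `S̃` seen as a subgroup of the centre. -/
def toCenter (ψ₀ : Q.St →ₜ* ℂˣ) : Q.St.subgroupOf (Subgroup.center Gt) →* ℂˣ :=
  (ψ₀ : Q.St →* ℂˣ).comp (Subgroup.subgroupOfEquivOfLe Q.St_le_center).toMonoidHom

/-- Abstract extensions of a genuine character of `S̃` to the centre are genuine characters. -/
def XgEquiv {ψ₀ : Q.St →ₜ* ℂˣ} (hψ₀ : P.IsGenuine ψ₀) :
    {F : Subgroup.center Gt →* ℂˣ // ∀ b : Q.St.subgroupOf (Subgroup.center Gt),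
      F b = toCenter ψ₀ b} ≃ Q.Xg Q.St_le_center ψ₀ where
  toFun F :=
    have hF : ∀ s : Q.St, F.1 ⟨s, Q.St_le_center s.2⟩ = ψ₀ s := fun s =>
      F.2 ⟨⟨s, Q.St_le_center s.2⟩, Subgroup.mem_subgroupOf.2 s.2⟩
    ⟨⟨⟨F.1, by
      -- Continuity is automatic: `F` agrees with the continuous `ψ₀` on the open subgroup `S̃`.
      -- Genuineness is inherited too, as `S̃` contains `Ker p`.
      refine continuous_of_continuousAt_one F.1 ?_
      have ho : IsOpen {z : Subgroup.center Gt | (z : Gt) ∈ Q.St} :=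
        Q.isOpen_St.preimage continuous_subtype_val
      refine (ContinuousOn.continuousAt (s := {z : Subgroup.center Gt | (z : Gt) ∈ Q.St}) ?_
        (ho.mem_nhds Q.St.one_mem))
      rw [continuousOn_iff_continuous_domRestrict]
      have : Continuous fun z : {z : Subgroup.center Gt | (z : Gt) ∈ Q.St} =>
          ψ₀ ⟨z, z.2⟩ :=
        ψ₀.continuous_toFun.comp ((continuous_subtype_val.comp continuous_subtype_val).subtype_mk _)
      exact this.congr fun z => (hF ⟨z, z.2⟩).symm⟩, fun z hz hz1 => by
        refine (hF ⟨z, Q.ker_mem_St hz⟩).trans (hψ₀ _ hz fun h => hz1 (Subtype.ext ?_))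
        exact congrArg (fun s : Q.St => (s : Gt)) h⟩, hF⟩
  invFun ψt := ⟨ψt.1.1, fun b => ψt.2 ⟨b, Subgroup.mem_subgroupOf.1 b.2⟩⟩
  left_inv _ := rfl
  right_inv _ := rfl

lemma finite_Xg {ψ₀ : Q.St →ₜ* ℂˣ} (hψ₀ : P.IsGenuine ψ₀) :
    Finite (Q.Xg Q.St_le_center ψ₀) :=
  have := Q.finiteIndex_St
  have := finite_extensions _ (toCenter ψ₀)
  Finite.of_equiv _ (XgEquiv hψ₀)

lemma card_Xg {ψ₀ : Q.St →ₜ* ℂˣ} (hψ₀ : P.IsGenuine ψ₀) :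
    Nat.card (Q.Xg Q.St_le_center ψ₀) = Q.φ.range.relIndex P.Z0 := by
  have := Q.finiteIndex_St
  rw [← Nat.card_congr (XgEquiv hψ₀), card_extensions, ← Q.relIndex_St]
  rfl

/-- Multiplication by a character `θ` trivial on `S̃` with `θ z ≠ 1` permutes the extensions and
scales the sum by `θ z`. -/
lemma sum_Xg {ψ₀ : Q.St →ₜ* ℂˣ} (hψ₀ : P.IsGenuine ψ₀) [Fintype (Q.Xg Q.St_le_center ψ₀)]
    {z : Subgroup.center Gt} (hz : (z : Gt) ∉ Q.St) :
    ∑ ψt : Q.Xg Q.St_le_center ψ₀, ((ψt.1.1 z : ℂˣ) : ℂ) = 0 := by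
  have := Q.finiteIndex_St
  obtain ⟨θ, hθ, hθz⟩ := MonoidHom.exists_apply_ne_one_of_notMem
    (Q.St.subgroupOf (Subgroup.center Gt)) (a := z) hz
  let e : {F : Subgroup.center Gt →* ℂˣ // ∀ b : Q.St.subgroupOf (Subgroup.center Gt),
      F b = toCenter ψ₀ b} ≃ {F : Subgroup.center Gt →* ℂˣ //
        ∀ b : Q.St.subgroupOf (Subgroup.center Gt), F b = toCenter ψ₀ b} :=
    (Equiv.mulLeft θ).subtypeEquiv fun F => forall_congr' fun b => by
      rw [Equiv.coe_mulLeft, MonoidHom.mul_apply, hθ b b.2, one_mul]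
  have h1 : ∀ ψt : Q.Xg Q.St_le_center ψ₀,
      ((XgEquiv hψ₀ (e ((XgEquiv hψ₀).symm ψt))).1.1 z : ℂˣ) = θ z * ψt.1.1 z := fun _ => rfl
  have h2 : ∑ ψt : Q.Xg Q.St_le_center ψ₀, ((ψt.1.1 z : ℂˣ) : ℂ) =
      (θ z : ℂ) * ∑ ψt : Q.Xg Q.St_le_center ψ₀, ((ψt.1.1 z : ℂˣ) : ℂ) := by
    rw [Finset.mul_sum, ← Equiv.sum_comp (((XgEquiv hψ₀).symm.trans e).trans (XgEquiv hψ₀))]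
    exact Finset.sum_congr rfl fun ψt _ => by
      rw [← Units.val_mul, ← h1]
      rfl
  by_contra h0
  exact hθz (Units.ext ((mul_eq_right₀ h0).1 h2.symm))

/-- Translation by `t` permutes each fibre of `φ` and scales the sum by `(χ t)⁻¹ ψ t ≠ 1`. -/
lemma lift_eq_zero (χt : P.GenuineChar) (χ ψ : Q.Gbar →ₜ* ℂˣ) {t : Q.Gbar} (ht : t ∈ Q.φ.ker)
    (hχψ : χ t ≠ ψ t) : Q.lift χt χ ψ = 0 := by
  funext g
  have hmem : ∀ h, h ∈ (Q.X_finite g).toFinset ↔ t * h ∈ (Q.X_finite g).toFinset := fun h => by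
    simp only [Set.Finite.mem_toFinset, X, Set.mem_ofPred_eq, map_mul, MonoidHom.mem_ker.1 ht,
      one_mul]
  have h1 : ∑ h ∈ (Q.X_finite g).toFinset, Q.transfer χt χ h g * ((ψ h : ℂˣ) : ℂ) =
      (((χ t)⁻¹ * ψ t : ℂˣ) : ℂ) *
        ∑ h ∈ (Q.X_finite g).toFinset, Q.transfer χt χ h g * ((ψ h : ℂˣ) : ℂ) := by
    rw [Finset.mul_sum]
    symm
    refine Finset.sum_bij (fun h _ => t * h) (fun h hh => (hmem h).1 hh)
      (fun a _ b _ hab => mul_left_cancel hab)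
      (fun b hb => ⟨t⁻¹ * b, (hmem _).2 (by rwa [mul_inv_cancel_left]), mul_inv_cancel_left _ _⟩)
      fun h _ => ?_
    unfold transfer
    split_ifs
    · simp only [map_mul, Units.val_mul, mul_inv, Units.val_inv_eq_inv_val]
      ring
    · simp
  rw [lift, Pi.zero_apply]
  rw [(?_ : ∑ h ∈ (Q.X_finite g).toFinset, Q.transfer χt χ h g * ((ψ h : ℂˣ) : ℂ) = 0), mul_zero]
  by_contra h0
  have : (χ t)⁻¹ * ψ t = 1 := Units.ext ((mul_eq_right₀ h0).1 h1.symm)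
  rw [inv_mul_eq_one] at this
  exact hχψ this

lemma lift_eq_zero_of_notMem (χt : P.GenuineChar) (χ ψ : Q.Gbar →ₜ* ℂˣ) {g : Gt}
    (hg : g ∉ Q.St) : Q.lift χt χ ψ g = 0 := by
  have : (Q.X_finite g).toFinset = ∅ := by
    rw [Set.Finite.toFinset_eq_empty, Set.eq_empty_iff_forall_notMem]
    exact fun h hh => hg ⟨h, hh⟩
  rw [lift, this, Finset.sum_empty, mul_zero]

lemma relIndex_ne_zero : Q.φ.range.relIndex P.Z0 ≠ 0 := by
  rw [← Q.relIndex_St]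
  exact Q.finiteIndex_St.1

/-- All terms equal `ψ₀ s`, and the fibre is a coset of `Ker φ`, whose order cancels against `c`.
The integer `d`, later the dimension of `τ̃`, replaces the real square root in `c`. -/
lemma lift_apply_St {χt : P.GenuineChar} {χ ψ : Q.Gbar →ₜ* ℂˣ} {ψ₀ : Q.St →ₜ* ℂˣ}
    (hψ₀ : Q.IsPsi0 Q.St_le_center χt χ ψ ψ₀) {d : ℕ} (hd : d ^ 2 = P.Z0.index) (s : Q.St) :
    Q.lift χt χ ψ s = d * Q.φ.range.relIndex P.Z0 * ((ψ₀ s : ℂˣ) : ℂ) := by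
  have h1 : ∀ h ∈ (Q.X_finite s).toFinset,
      Q.transfer χt χ h s * ((ψ h : ℂˣ) : ℂ) = ((ψ₀ s : ℂˣ) : ℂ) := fun h hh => by
    rw [Set.Finite.mem_toFinset] at hh
    rw [hψ₀.2 s h hh, transfer, dif_pos (Q.St_le_center s.2)]
    push_cast
    ring
  have h2 : (Q.X_finite s).toFinset.card = Nat.card Q.φ.ker := by
    obtain ⟨a, ha⟩ := s.2
    rw [← Nat.card_eq_card_finite_toFinset]
    refine Nat.card_congr ⟨fun h => ⟨a⁻¹ * h, ?_⟩, fun k => ⟨a * k, ?_⟩, fun h => ?_, fun k => ?_⟩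
    · rw [MonoidHom.mem_ker, map_mul, map_inv, ha, h.2, inv_mul_cancel]
    · rw [X, Set.mem_ofPred_eq, map_mul, ha, MonoidHom.mem_ker.1 k.2, mul_one]
    · exact Subtype.ext (mul_inv_cancel_left _ _)
    · exact Subtype.ext (inv_mul_cancel_left _ _)
  have h3 : (Nat.card Q.φ.ker : ℂ) ≠ 0 := by
    have := Q.finite_ker_φ
    exact_mod_cast (Nat.card_pos (α := Q.φ.ker)).ne'
  have h4 : (P.Z0.index : ℝ) ^ (-(1 / 2) : ℝ) = (d : ℝ)⁻¹ := by
    rw [← hd, Nat.cast_pow, ← Real.rpow_natCast, ← Real.rpow_mul (Nat.cast_nonneg d)]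
    norm_num
    exact Real.rpow_neg_one _
  rw [lift, Finset.sum_congr rfl h1, Finset.sum_const, h2, nsmul_eq_mul, c, h4]
  push_cast
  simp only [mul_inv, inv_inv]
  field_simp

end TwoSubgroup

end TwoFoldCover

end

/-! ### One-parameter groups and differentials. -/

noncomputable section

open Filter Topology

section OneParameter

/-- Integrating `f (x + t) = f x * f t` over `t` in `[0, δ]` expresses `f` through its primitive
`F`. Some `F δ` is nonzero because `F' 0 = 1`. -/
lemma exists_hasDerivAt_of_map_add {f : ℝ → ℂ} (hf : Continuous f) (h0 : f 0 = 1)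
    (hadd : ∀ s t, f (s + t) = f s * f t) : ∃ a, HasDerivAt f a 0 := by
  set F : ℝ → ℂ := fun x => ∫ t in (0 : ℝ)..x, f t with hF
  have hFd : ∀ x, HasDerivAt F (f x) x := fun x =>
    intervalIntegral.integral_hasDerivAt_right (hf.intervalIntegrable _ _)
      (hf.stronglyMeasurableAtFilter _ _) hf.continuousAt
  obtain ⟨δ, hδ⟩ : ∃ δ, F δ ≠ 0 := by
    by_contra! h
    have h1 : F = fun _ => 0 := funext h
    have h2 := hFd 0
    rw [h1, h0] at h2
    exact zero_ne_one ((hasDerivAt_const (0 : ℝ) (0 : ℂ)).unique h2)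
  have key : ∀ x, f x = (F (x + δ) - F x) / F δ := by
    intro x
    rw [eq_div_iff hδ, hF]
    simp only
    rw [intervalIntegral.integral_interval_sub_left (hf.intervalIntegrable _ _)
      (hf.intervalIntegrable _ _), ← intervalIntegral.integral_const_mul]
    simp_rw [← hadd]
    rw [intervalIntegral.integral_comp_add_left (fun t => f t), add_zero]
  exact ⟨_, ((((hFd (0 + δ)).comp_add_const 0 δ).sub (hFd 0)).div_const
    (F δ)).congr_of_eventuallyEq (Eventually.of_forall key)⟩

lemma exists_linearMap_hasDerivAt {E : Type*} [AddCommGroup E] [Module ℝ E] (f : E → ℂˣ)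
    (hadd : ∀ X Y, f (X + Y) = f X * f Y)
    (hc : ∀ X, Continuous fun t : ℝ => ((f (t • X) : ℂˣ) : ℂ)) :
    ∃ d : E →ₗ[ℝ] ℂ, ∀ X, HasDerivAt (fun t : ℝ => ((f (t • X) : ℂˣ) : ℂ)) (d X) 0 := by
  have h0 : f 0 = 1 := by
    have := hadd 0 0
    rwa [add_zero, left_eq_mul] at this
  have h : ∀ X, ∃ a, HasDerivAt (fun t : ℝ => ((f (t • X) : ℂˣ) : ℂ)) a 0 := fun X =>
    exists_hasDerivAt_of_map_add (hc X) (by rw [zero_smul, h0, Units.val_one])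
      fun s t => by rw [add_smul, hadd, Units.val_mul]
  choose a ha using h
  refine ⟨{ toFun := a, map_add' := fun X Y => ?_, map_smul' := fun c X => ?_ }, ha⟩
  · have h1 := (ha X).mul (ha Y)
    simp only [zero_smul, h0, Units.val_one, mul_one, one_mul] at h1
    refine (ha (X + Y)).unique (h1.congr_of_eventuallyEq (Eventually.of_forall fun t => ?_))
    simp only [smul_add, hadd, Units.val_mul, Pi.mul_apply]
  · have h1 : HasDerivAt (fun t : ℝ => t * c) c 0 := by
      simpa using (hasDerivAt_id (0 : ℝ)).mul_const c
    have h2 := HasDerivAt.scomp_of_eq (0 : ℝ) (ha X) h1 (by simp)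
    refine (ha (c • X)).unique (h2.congr_of_eventuallyEq (Eventually.of_forall fun t => ?_))
    simp only [Function.comp_apply, smul_smul]

end OneParameter

namespace TwoFoldCover

variable {T : RealTorus} {Gt : Type u} [Group Gt] [TopologicalSpace Gt] [IsTopologicalGroup Gt]
  (P : TwoFoldCover T Gt)

/-- The square of any lift of an element of `G`; it does not depend on the lift. -/
def sqLift (g : T.G) : Subgroup.center Gt :=
  ⟨Function.surjInv P.surjective g ^ 2, P.sq_mem_center _⟩

/-- Two lifts differ by a central element of square `1`. -/
lemma sqLift_p (a : Gt) : (P.sqLift (P.p a) : Gt) = a ^ 2 := by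
  have h1 : P.p (Function.surjInv P.surjective (P.p a) * a⁻¹) = 1 := by
    rw [map_mul, Function.surjInv_eq P.surjective, map_inv, mul_inv_cancel]
  have h2 := Subgroup.mem_center_iff.1 (P.ker_mem_center h1) a
  have h3 := P.ker_sq h1
  set b := Function.surjInv P.surjective (P.p a)
  have h4 : b = b * a⁻¹ * a := by group
  change b ^ 2 = a ^ 2
  rw [h4]
  generalize b * a⁻¹ = k at h2 h3
  rw [sq, mul_assoc, ← mul_assoc a, h2, ← mul_assoc, ← mul_assoc, h3, one_mul, sq]

lemma p_sqLift (g : T.G) : P.p (P.sqLift g) = g ^ 2 := by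
  obtain ⟨a, rfl⟩ := P.surjective g
  rw [sqLift_p, map_pow]

/-- Squaring need not be multiplicative on `G̃`; it is when one factor is central. -/
lemma sqLift_mul {g : T.G} (hg : g ∈ P.Z0) (g' : T.G) :
    P.sqLift (g * g') = P.sqLift g * P.sqLift g' := by
  obtain ⟨a, ha, rfl⟩ := hg
  obtain ⟨b, rfl⟩ := P.surjective g'
  refine Subtype.ext ?_
  rw [Subgroup.coe_mul, ← map_mul, sqLift_p, sqLift_p, sqLift_p]
  exact Commute.mul_pow (Subgroup.mem_center_iff.1 ha b).symm 2

lemma continuousAt_sqLift : ContinuousAt P.sqLift 1 := by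
  obtain ⟨l, hlc, -, hl⟩ := P.exists_local_section
  rw [Topology.IsEmbedding.subtypeVal.continuousAt_iff]
  refine (hlc.pow 2).congr ?_
  filter_upwards [hl] with g hg
  rw [Function.comp_apply]
  conv_rhs => rw [← hg]
  exact (P.sqLift_p _).symm

/-- The exponential map of `𝔤`, lifted to the centre of `G̃`. -/
def expCenter (X : T.lie) : Subgroup.center Gt := P.sqLift (T.expG ((1 / 2 : ℝ) • X))

lemma expCenter_add (X Y : T.lie) :
    P.expCenter (X + Y) = P.expCenter X * P.expCenter Y := by
  rw [expCenter, smul_add, T.expG_add, sqLift_mul]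
  · rfl
  -- The element `exp (X/2) = exp (X/4)²` is a square, so it lies in `p(Z(G̃))`.
  · rw [← T.expG_half_sq]
    exact P.sq_mem_Z0 _

lemma p_expCenter (X : T.lie) : P.p (P.expCenter X) = T.expG X := by
  rw [expCenter, p_sqLift, T.expG_half_sq]

/-- The lift of the one-parameter group of `X` to the centre of `G̃`. -/
def oneParam (X : T.lie) : Multiplicative ℝ →ₜ* Subgroup.center Gt :=
  let f : Multiplicative ℝ →* Subgroup.center Gt := MonoidHom.mk'
    (fun t => P.expCenter (t.toAdd • X))
    fun s t => by rw [toAdd_mul, add_smul, expCenter_add]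
  { f with
    continuous_toFun := by
      refine continuous_of_continuousAt_one f ?_
      have h1 : Continuous fun t : Multiplicative ℝ => T.expG ((1 / 2 : ℝ) • t.toAdd • X) :=
        T.continuous_expG.comp (by fun_prop)
      have h2 : T.expG ((1 / 2 : ℝ) • (1 : Multiplicative ℝ).toAdd • X) = 1 := by
        rw [toAdd_one, zero_smul, smul_zero, T.expG_zero]
      refine ContinuousAt.comp
        (f := fun t : Multiplicative ℝ => T.expG ((1 / 2 : ℝ) • t.toAdd • X)) (g := P.sqLift)
        ?_ h1.continuousAt
      rw [h2]
      exact P.continuousAt_sqLift }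

lemma oneParam_ofAdd (X : T.lie) (t : ℝ) :
    P.oneParam X (Multiplicative.ofAdd t) = P.expCenter (t • X) := rfl

lemma hasDifferential_of_hasDerivAt {χ : Subgroup.center Gt →ₜ* ℂˣ} {d : T.lie →ₗ[ℝ] ℂ}
    (h : ∀ X, HasDerivAt (fun t : ℝ => ((χ (P.expCenter (t • X)) : ℂˣ) : ℂ)) (d X) 0) :
    P.HasDifferential χ d :=
  fun X => ⟨P.oneParam X, fun t => P.p_expCenter (t • X), h X⟩

lemma exists_differential (χ : Subgroup.center Gt →ₜ* ℂˣ) : ∃ d : T.lie →ₗ[ℝ] ℂ,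
    ∀ X, HasDerivAt (fun t : ℝ => ((χ (P.expCenter (t • X)) : ℂˣ) : ℂ)) (d X) 0 := by
  refine exists_linearMap_hasDerivAt (fun X => χ (P.expCenter X))
    (fun X Y => by rw [expCenter_add, map_mul]) fun X => ?_
  exact Units.continuous_val.comp
    (χ.continuous_toFun.comp ((P.oneParam X).continuous_toFun.comp continuous_ofAdd))

namespace TwoSubgroup

variable {P} (Q : TwoSubgroup P)

lemma exists_differential (ψ : Q.Gbar →ₜ* ℂˣ) : ∃ d : T.lie →ₗ[ℝ] ℂ, Q.HasDifferential ψ d := by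
  refine exists_linearMap_hasDerivAt (fun X => ψ (Q.pbar (T.expG X)))
    (fun X Y => by rw [T.expG_add, map_mul, map_mul]) fun X => ?_
  exact Units.continuous_val.comp (ψ.continuous_toFun.comp (Q.continuous_pbar.comp
    (T.continuous_expG.comp (continuous_id.smul continuous_const))))

variable {Q}

lemma expCenter_mem_X (X : T.lie) :
    Q.pbar (T.expG ((1 / 2 : ℝ) • X)) ∈ Q.X (P.expCenter X : Gt) := by
  rw [TwoSubgroup.X, Set.mem_ofPred_eq, φ_pbar, p_expCenter, T.expG_half_sq]

/-- The lifted exponential takes values in `S̃`, where every extension is given by the formula for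
`ψ̃₀` with `h` the image of `exp (X/2)`. The product rule gives `dχ̃ + (dψ - dχ)/2`. -/
lemma hasDifferential_Xg {χt : P.GenuineChar} {χ ψ : Q.Gbar →ₜ* ℂˣ} {ψ₀ : Q.St →ₜ* ℂˣ}
    (hψ₀ : Q.IsPsi0 Q.St_le_center χt χ ψ ψ₀) {dχt dχ dψ : T.lie →ₗ[ℝ] ℂ}
    (hχt : ∀ X, HasDerivAt (fun t : ℝ => ((χt.1 (P.expCenter (t • X)) : ℂˣ) : ℂ)) (dχt X) 0)
    (hχ : Q.HasDifferential χ dχ) (hψ : Q.HasDifferential ψ dψ) {ψt : P.GenuineChar}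
    (hψt : ψt ∈ Q.Xg Q.St_le_center ψ₀) :
    P.HasDifferential ψt.1 ((1 / 2 : ℝ) • (dψ - (dχ - (2 : ℝ) • dχt))) := by
  refine P.hasDifferential_of_hasDerivAt fun X => ?_
  have hval : ∀ X : T.lie, ψt.1 (P.expCenter X) = χt.1 (P.expCenter X) *
      ψ (Q.pbar (T.expG ((1 / 2 : ℝ) • X))) * (χ (Q.pbar (T.expG ((1 / 2 : ℝ) • X))))⁻¹ := by
    intro X
    have hs : (P.expCenter X : Gt) ∈ Q.St := ⟨_, expCenter_mem_X X⟩
    rw [← hψ₀.2 ⟨_, hs⟩ _ (expCenter_mem_X X), ← hψt]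
  have hone : ∀ ξ : Q.Gbar →ₜ* ℂˣ, ξ (Q.pbar (T.expG ((0 : ℝ) • (1 / 2 : ℝ) • X))) = 1 := by
    intro ξ
    rw [zero_smul, T.expG_zero, map_one, map_one]
  have hone' : χt.1 (P.expCenter ((0 : ℝ) • X)) = 1 := by
    rw [← P.oneParam_ofAdd, ofAdd_zero, map_one, map_one]
  have h1 := ((hχt X).mul (hψ ((1 / 2 : ℝ) • X))).mul
    ((hχ ((1 / 2 : ℝ) • X)).fun_inv (by rw [hone]; simp))
  simp only [hone, hone', Units.val_one, mul_one, one_mul, inv_one, one_pow, div_one, Pi.mul_apply] at h1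
  refine (h1.congr_of_eventuallyEq (Eventually.of_forall fun t => ?_)).congr_deriv ?_
  · simp only [hval, Units.val_mul, Units.val_inv_eq_inv_val, Pi.mul_apply, smul_comm t]
  · simp only [map_smul, LinearMap.smul_apply, LinearMap.sub_apply, Complex.real_smul]
    push_cast
    ring

end TwoSubgroup

end TwoFoldCover

end

/-! ### Genuine representations and their characters. -/

noncomputable section

open Module

lemma DirectSum.trace_lmap {ι : Type*} [Fintype ι] {V : ι → Type*} [∀ i, AddCommGroup (V i)]
    [∀ i, Module ℂ (V i)] [∀ i, FiniteDimensional ℂ (V i)] (f : ∀ i, V i →ₗ[ℂ] V i) :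
    LinearMap.trace ℂ (DirectSum ι V) (DirectSum.lmap f) = ∑ i, LinearMap.trace ℂ (V i) (f i) := by
  classical
  let b : Basis (Σ i, Fin (finrank ℂ (V i))) ℂ (DirectSum ι V) :=
    DFinsupp.basis fun i => finBasis ℂ (V i)
  have hb : ∀ x i j, b.repr x ⟨i, j⟩ = (finBasis ℂ (V i)).repr (x i) j := fun _ _ _ => rfl
  rw [LinearMap.trace_eq_matrix_trace ℂ b, Matrix.trace, Fintype.sum_sigma]
  refine Finset.sum_congr rfl fun i _ => ?_
  rw [LinearMap.trace_eq_matrix_trace ℂ (finBasis ℂ (V i)), Matrix.trace]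
  refine Finset.sum_congr rfl fun j _ => ?_
  have h1 : b ⟨i, j⟩ = DirectSum.lof ℂ ι V i (finBasis ℂ (V i) j) := by
    refine b.apply_eq_iff.2 (Finsupp.ext fun ⟨k, l⟩ => ?_)
    rw [hb]
    by_cases hk : i = k
    · subst hk
      rw [DirectSum.lof_apply, Basis.repr_self]
      simp [Finsupp.single_apply]
    · rw [DirectSum.lof_eq_of, DirectSum.of_eq_of_ne _ _ _ (Ne.symm hk), map_zero, Finsupp.zero_apply,
        Finsupp.single_eq_of_ne]
      exact fun h => hk (congrArg Sigma.fst h).symm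
  rw [Matrix.diag_apply, Matrix.diag_apply, LinearMap.toMatrix_apply, LinearMap.toMatrix_apply, h1,
    DirectSum.lmap_lof, hb, DirectSum.lof_apply]

namespace TwoFoldCover

variable {T : RealTorus} {Gt : Type u} [Group Gt] [TopologicalSpace Gt] [IsTopologicalGroup Gt]
  {P : TwoFoldCover T Gt}

namespace GenuineRep

lemma IsTau.hasCentralChar {τ : GenuineRep.{u, v} P} {ψt : P.GenuineChar} (h : τ.IsTau ψt) :
    τ.ρ.HasCentralChar (ψt.1 : Subgroup.center Gt →* ℂˣ) := h.2

lemma IsTau.iso {τ : GenuineRep.{u, v} P} {τ' : GenuineRep.{u, w} P} {ψt : P.GenuineChar}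
    (h : τ.IsTau ψt) (h' : τ'.IsTau ψt) : τ.Iso τ' :=
  have := P.finiteIndex_center
  h.hasCentralChar.nonempty_equiv h'.hasCentralChar ψt.isHeisenberg h.1 h'.1

lemma exists_isTau (ψt : P.GenuineChar) : ∃ τ : GenuineRep.{u, v} P, τ.IsTau ψt := by
  have := P.finiteIndex_center
  obtain ⟨n, ρ, hρ, hc⟩ := Representation.exists_isIrreducible_hasCentralChar.{v}
    (ψt.1 : Subgroup.center Gt →* ℂˣ)
  refine ⟨{ V := ULift.{v} (Fin n → ℂ)
            ρ := ρ
            continuous_coeff := fun f x => ?_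
            genuine := fun g hg hg1 x => ?_ }, hρ, hc⟩
  -- On the open coset of the centre through `g₀`, `ρ g` is the scalar `ψt (g * g₀⁻¹)` times `ρ g₀`.
  · refine continuous_iff_continuousAt.2 fun g₀ => ?_
    let U : Set Gt := {g | g * g₀⁻¹ ∈ Subgroup.center Gt}
    have hU : IsOpen U := P.isOpen_center.preimage (continuous_mul_const g₀⁻¹)
    have hg₀ : g₀ ∈ U := by
      change g₀ * g₀⁻¹ ∈ Subgroup.center Gt
      rw [mul_inv_cancel]
      exact one_mem _
    refine ContinuousOn.continuousAt (s := U) ?_ (hU.mem_nhds hg₀)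
    rw [continuousOn_iff_continuous_domRestrict]
    have h1 : Continuous fun g : U => ((ψt.1 ⟨g * g₀⁻¹, g.2⟩ : ℂˣ) : ℂ) * f (ρ g₀ x) :=
      (Units.continuous_val.comp (ψt.1.continuous_toFun.comp
        ((continuous_subtype_val.mul continuous_const).subtype_mk _))).mul continuous_const
    refine h1.congr fun g => ?_
    have h2 := hc ⟨g * g₀⁻¹, g.2⟩ (ρ g₀ x)
    rw [← Module.End.mul_apply, ← map_mul, inv_mul_cancel_right] at h2
    rw [Set.domRestrict_apply, h2, map_smul, smul_eq_mul]
    rfl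
  · have h1 := hc ⟨g, P.ker_mem_center hg⟩ x
    have h2 := ψt.2 ⟨g, P.ker_mem_center hg⟩ hg fun h => hg1 (congrArg Subtype.val h)
    rw [show (ψt.1 : Subgroup.center Gt →* ℂˣ) ⟨g, P.ker_mem_center hg⟩ = -1 from h2] at h1
    simpa using h1

lemma IsTau.finrank_sq {τ : GenuineRep.{u, v} P} {ψt : P.GenuineChar} (h : τ.IsTau ψt) :
    finrank ℂ τ.V ^ 2 = P.Z0.index := by
  have := P.finiteIndex_center
  rw [P.index_Z0]
  exact h.hasCentralChar.finrank_sq ψt.isHeisenberg h.1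

lemma IsTau.character_center {τ : GenuineRep.{u, v} P} {ψt : P.GenuineChar} (h : τ.IsTau ψt)
    (z : Subgroup.center Gt) : τ.character z = ((ψt.1 z : ℂˣ) : ℂ) * finrank ℂ τ.V :=
  h.hasCentralChar.trace_center z

lemma IsTau.character_eq_zero {τ : GenuineRep.{u, v} P} {ψt : P.GenuineChar} (h : τ.IsTau ψt)
    {g : Gt} (hg : g ∉ Subgroup.center Gt) : τ.character g = 0 :=
  h.hasCentralChar.trace_eq_zero ψt.isHeisenberg hg

lemma character_one (π : GenuineRep.{u, v} P) : π.character 1 = finrank ℂ π.V := by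
  rw [character, map_one, LinearMap.trace_one]

section DirectSum

variable {ι : Type u} [Finite ι] (τ : ι → GenuineRep.{u, v} P)

lemma character_directSum [Fintype ι] : (directSum τ).character = ∑ i, (τ i).character := by
  classical
  funext g
  rw [Finset.sum_apply]
  exact DirectSum.trace_lmap fun i => (τ i).ρ g

lemma isSemisimple_directSum (h : ∀ i, (τ i).ρ.IsSemisimpleRepresentation) :
    (directSum τ).ρ.IsSemisimpleRepresentation := by
  classical
  let f : ∀ i, (τ i).ρ.IntertwiningMap (directSum τ).ρ := fun i =>
    ⟨DirectSum.lof ℂ ι (fun i => (τ i).V) i, fun g => LinearMap.ext fun x =>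
      (DirectSum.lmap_lof (fun i => (τ i).ρ g) i x).symm⟩
  rw [Representation.isSemisimpleRepresentation_iff_isSemisimpleModule_asModule]
  have h' := fun i =>
    (Representation.isSemisimpleRepresentation_iff_isSemisimpleModule_asModule _).1 (h i)
  let F := fun i => Representation.IntertwiningMap.equivLinearMapAsModule _ _ (f i)
  refine isSemisimpleModule_of_isSemisimpleModule_submodule' (p := fun i => LinearMap.range (F i))
    (fun i => have := h' i; IsSemisimpleModule.range (F i)) ?_
  have key : ∀ x : (directSum τ).V,
      (directSum τ).ρ.asModuleEquiv.symm x ∈ ⨆ i, LinearMap.range (F i) := by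
    intro x
    induction x using DirectSum.induction_on with
    | zero => exact zero_mem _
    | of i y => exact Submodule.mem_iSup_of_mem i ⟨y, rfl⟩
    | add x y hx hy => exact add_mem hx hy
  exact eq_top_iff.2 fun x _ => key x

end DirectSum

section Isotypic

variable (π : GenuineRep.{u, w} P)

/-- The subspace on which the centre acts through a genuine character. -/
def isotypic (ψt : P.GenuineChar) : Subrepresentation π.ρ where
  toSubmodule :=
    { carrier := {x | ∀ z : Subgroup.center Gt, π.ρ z x = ((ψt.1 z : ℂˣ) : ℂ) • x}
      add_mem' := fun hx hy z => by rw [map_add, hx z, hy z, smul_add]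
      zero_mem' := fun z => by rw [map_zero, smul_zero]
      smul_mem' := fun c x hx z => by rw [map_smul, hx z, smul_comm] }
  apply_mem_toSubmodule g x hx z := by
    rw [← Module.End.mul_apply, ← map_mul, ← Subgroup.mem_center_iff.1 z.2 g, map_mul,
      Module.End.mul_apply, hx z, map_smul]

lemma isotypic_hasCentralChar (ψt : P.GenuineChar) :
    (π.isotypic ψt).toRepresentation.HasCentralChar (ψt.1 : Subgroup.center Gt →* ℂˣ) :=
  fun z x => Subtype.ext (x.2 z)

/-- Schur's lemma makes the centre act on `A` by scalars. They form a continuous character, being a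
matrix coefficient `f (π z x₀)` divided by `f x₀ ≠ 0`. -/
lemma exists_le_isotypic (A : Subrepresentation π.ρ) (hA : A.toRepresentation.IsIrreducible) :
    ∃ ψt : P.GenuineChar, A ≤ π.isotypic ψt := by
  have hV := ((Representation.isIrreducible_iff_forall_submodule _).1 hA).1
  have hscal : ∀ z : Subgroup.center Gt, ∃ c : ℂ, ∀ x ∈ A.toSubmodule, π.ρ z x = c • x := by
    intro z
    let F : A.toRepresentation.IntertwiningMap A.toRepresentation :=
      ⟨A.toRepresentation z, fun g => by
        change A.toRepresentation z * A.toRepresentation g =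
          A.toRepresentation g * A.toRepresentation z
        rw [← map_mul, ← map_mul, Subgroup.mem_center_iff.1 z.2 g]⟩
    obtain ⟨c, hc⟩ :=
      Representation.IsIrreducible.algebraMap_intertwiningMap_bijective_of_isAlgClosed.2 F
    refine ⟨c, fun x hx => ?_⟩
    have h1 : F ⟨x, hx⟩ = c • (⟨x, hx⟩ : A.toSubmodule) := by
      rw [← hc]
      rfl
    exact congrArg Subtype.val h1
  choose c hc using hscal
  obtain ⟨⟨x₀, hx₀⟩, hne⟩ := exists_ne (0 : A.toSubmodule)
  have hne : x₀ ≠ 0 := fun h => hne (Subtype.ext h)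
  obtain ⟨f, hf⟩ : ∃ f : π.V →ₗ[ℂ] ℂ, f x₀ ≠ 0 := by
    by_contra! h
    exact hne ((forall_dual_apply_eq_zero_iff ℂ x₀).1 h)
  let cm : Subgroup.center Gt →* ℂ :=
    { toFun := c
      map_one' := smul_left_injective ℂ hne (by
        simp only
        rw [← hc 1 x₀ hx₀, one_smul, OneMemClass.coe_one, map_one, Module.End.one_apply])
      map_mul' := fun z z' => smul_left_injective ℂ hne (by
        simp only
        rw [← hc _ x₀ hx₀, Subgroup.coe_mul, map_mul, Module.End.mul_apply, hc z' x₀ hx₀, map_smul,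
          hc z x₀ hx₀, smul_smul, mul_comm]) }
  have hcont : Continuous cm.toHomUnits := by
    rw [Units.isEmbedding_val₀.continuous_iff]
    refine (((π.continuous_coeff f x₀).comp continuous_subtype_val).div_const (f x₀)).congr
      fun z => ?_
    simp [hc z x₀ hx₀, hf, cm]
  refine ⟨⟨⟨cm.toHomUnits, hcont⟩, fun k hk hk1 => Units.ext ?_⟩, fun x hx z => hc z x hx⟩
  change c k = _
  refine smul_left_injective ℂ hne ?_
  simp only
  rw [← hc k x₀ hx₀, π.genuine k hk fun h => hk1 (Subtype.ext h)]
  simp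

/-- These are joint eigenspaces of a commuting family, contained in the independent joint
generalized eigenspaces. -/
lemma iSupIndep_isotypic : iSupIndep fun ψt => (π.isotypic ψt).toSubmodule := by
  have h1 := Module.End.independent_iInf_maxGenEigenspace_of_forall_mapsTo
    (fun z : Subgroup.center Gt => π.ρ z) fun z z' μ => by
      refine Module.End.mapsTo_maxGenEigenspace_of_comm ?_ μ
      change π.ρ z' * π.ρ z = π.ρ z * π.ρ z'
      rw [← map_mul, ← map_mul, Subgroup.mem_center_iff.1 z.2]
  have hinj : Function.Injective
      fun (ψt : P.GenuineChar) (z : Subgroup.center Gt) => ((ψt.1 z : ℂˣ) : ℂ) := by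
    intro a b hab
    exact Subtype.ext (DFunLike.ext _ _ fun z => Units.ext (congrFun hab z))
  refine (h1.comp hinj).mono fun ψt x hx => ?_
  simp only [Function.comp_apply, Submodule.mem_iInf]
  intro z
  refine (Module.End.mem_maxGenEigenspace _ _ _).2 ⟨1, ?_⟩
  rw [pow_one, LinearMap.sub_apply, hx z]
  simp

/-- A nonzero complement of the sum would contain an irreducible, which lies in some isotypic
subspace. -/
lemma iSup_isotypic (hπ : π.ρ.IsSemisimpleRepresentation) :
    ⨆ ψt, (π.isotypic ψt).toSubmodule = ⊤ := by
  let S : Subrepresentation π.ρ := ⟨⨆ ψt, (π.isotypic ψt).toSubmodule, fun g x hx => by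
    have h1 : (⨆ ψt, (π.isotypic ψt).toSubmodule).map (π.ρ g) ≤
        ⨆ ψt, (π.isotypic ψt).toSubmodule := by
      rw [Submodule.map_iSup]
      refine iSup_mono fun ψt => ?_
      rintro _ ⟨y, hy, rfl⟩
      exact (π.isotypic ψt).apply_mem_toSubmodule g hy
    exact h1 ⟨x, hx, rfl⟩⟩
  obtain ⟨S', hS'⟩ := exists_isCompl S
  have h0 : S'.toSubmodule = ⊥ := by
    by_contra h
    obtain ⟨A, hAS, hA⟩ := π.ρ.exists_isIrreducible_le S'.toSubmodule
      (fun g x hx => S'.apply_mem_toSubmodule g hx) h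
    obtain ⟨ψt, hψt⟩ := π.exists_le_isotypic A hA
    have hAS' : A ≤ S := fun x hx => Submodule.mem_iSup_of_mem ψt (hψt hx)
    have hbot : A = ⊥ := le_bot_iff.1 (hS'.disjoint hAS' hAS)
    have hV := ((Representation.isIrreducible_iff_forall_submodule _).1 hA).1
    rw [Submodule.nontrivial_iff_ne_bot, hbot] at hV
    exact hV rfl
  have h1 : S' = ⊥ := Subrepresentation.toSubmodule_injective h0
  have h2 := hS'.sup_eq_top
  rw [h1, sup_bot_eq] at h2
  exact congrArg Subrepresentation.toSubmodule h2

lemma finite_isotypic : {ψt | (π.isotypic ψt).toSubmodule ≠ ⊥}.Finite :=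
  WellFoundedGT.finite_ne_bot_of_iSupIndep π.iSupIndep_isotypic

lemma character_center (hπ : π.ρ.IsSemisimpleRepresentation) (z : Subgroup.center Gt)
    (s : Finset P.GenuineChar) (hs : π.finite_isotypic.toFinset ⊆ s) :
    π.character z =
      ∑ ψt ∈ s, (finrank ℂ (π.isotypic ψt).toSubmodule : ℂ) * ((ψt.1 z : ℂˣ) : ℂ) := by
  classical
  have hint := DirectSum.isInternal_submodule_of_iSupIndep_of_iSup_eq_top π.iSupIndep_isotypic
    (π.iSup_isotypic hπ)
  rw [character, LinearMap.trace_eq_sum_trace_restrict' hint π.finite_isotypic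
    fun ψt x hx => (π.isotypic ψt).apply_mem_toSubmodule z hx]
  have h1 : ∀ ψt, LinearMap.trace ℂ (π.isotypic ψt).toSubmodule
      ((π.ρ z).restrict fun x hx => (π.isotypic ψt).apply_mem_toSubmodule z hx) =
      (finrank ℂ (π.isotypic ψt).toSubmodule : ℂ) * ((ψt.1 z : ℂˣ) : ℂ) := fun ψt =>
    ((π.isotypic_hasCentralChar ψt).trace_center z).trans (mul_comm _ _)
  rw [Finset.sum_congr rfl fun ψt _ => h1 ψt]
  refine Finset.sum_subset hs fun ψt _ hψt => ?_
  simp only [Set.Finite.mem_toFinset, Set.mem_ofPred_eq, not_not] at hψt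
  rw [hψt, finrank_bot, Nat.cast_zero, zero_mul]

lemma linearIndependent_genuineChar : LinearIndependent ℂ
    fun (ψt : P.GenuineChar) (z : Subgroup.center Gt) => ((ψt.1 z : ℂˣ) : ℂ) := by
  have h := (linearIndependent_monoidHom (Subgroup.center Gt) ℂ).comp
    (fun ψt : P.GenuineChar => (Units.coeHom ℂ).comp (ψt.1 : Subgroup.center Gt →* ℂˣ))
    fun a b hab => Subtype.ext (DFunLike.ext _ _ fun z => Units.ext (DFunLike.congr_fun hab z))
  exact h

variable {π}

/-- On the centre both traces are combinations of genuine characters with these dimensions as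
coefficients; linear independence equates them. -/
lemma finrank_isotypic {X : Set P.GenuineChar} [Finite X] {τ : X → GenuineRep.{u, v} P}
    (hτ : ∀ ψt, (τ ψt).IsTau ψt) (hπ : π.ρ.IsSemisimpleRepresentation)
    (hchar : π.character = (directSum τ).character) :
    (∀ ψt : X, finrank ℂ (π.isotypic ψt).toSubmodule = finrank ℂ (τ ψt).V) ∧
      ∀ ψt ∉ X, (π.isotypic ψt).toSubmodule = ⊥ := by
  classical
  have := Fintype.ofFinite X
  let m : P.GenuineChar → ℕ := fun ψt => if h : ψt ∈ X then finrank ℂ (τ ⟨ψt, h⟩).V else 0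
  let s := π.finite_isotypic.toFinset ∪ X.toFinset
  have hsum : ∀ z : Subgroup.center Gt,
      ∑ ψt ∈ s, (m ψt : ℂ) * ((ψt.1 z : ℂˣ) : ℂ) = (directSum τ).character z := by
    intro z
    rw [character_directSum, Finset.sum_apply,
      ← Finset.sum_subset (Finset.subset_union_right : X.toFinset ⊆ s),
      ← Finset.sum_coe_sort X.toFinset]
    · refine Fintype.sum_equiv (Equiv.subtypeEquivRight fun _ => Set.mem_toFinset) _ _ fun ψt => ?_
      have hX : (ψt : P.GenuineChar) ∈ X := Set.mem_toFinset.1 ψt.2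
      rw [(hτ _).character_center, mul_comm]
      simp only [m, dif_pos hX]
      rfl
    · intro ψt _ hψt
      have hX : ψt ∉ X := fun h => hψt (Set.mem_toFinset.2 h)
      simp [m, hX]
  have key : ∀ ψt, finrank ℂ (π.isotypic ψt).toSubmodule = m ψt := by
    intro ψt
    by_cases hs : ψt ∈ s
    · have h1 := linearIndependent_iff'.1 (linearIndependent_genuineChar (P := P)) s
        (fun ψt => (finrank ℂ (π.isotypic ψt).toSubmodule : ℂ) - m ψt) (by
          funext z
          rw [Finset.sum_apply]
          simp only [Pi.smul_apply, smul_eq_mul, sub_mul, Finset.sum_sub_distrib]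
          rw [hsum, ← π.character_center hπ z s Finset.subset_union_left, hchar, sub_self]
          rfl) ψt hs
      exact_mod_cast sub_eq_zero.1 h1
    · simp only [s, Finset.mem_union, Set.Finite.mem_toFinset, Set.mem_ofPred_eq, not_or, not_not,
        Set.mem_toFinset] at hs
      simp [m, hs.1, hs.2]
  refine ⟨fun ψt => ?_, fun ψt hψt => ?_⟩
  · rw [key]
    simp [m]
  · rw [← Submodule.finrank_eq_zero, key]
    simp [m, hψt]

/-- For `ψt` in `X`, the isotypic subspace has dimension `d` with `d² = |G̃/Z(G̃)|`, so it is
irreducible and isomorphic to `τ ψt`. The assembled map is onto, and the characters at `1` show that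
the dimensions agree. -/
lemma iso_directSum {X : Set P.GenuineChar} [Finite X] {τ : X → GenuineRep.{u, v} P}
    (hτ : ∀ ψt, (τ ψt).IsTau ψt) (hπ : π.ρ.IsSemisimpleRepresentation)
    (hchar : π.character = (directSum τ).character) : π.Iso (directSum τ) := by
  classical
  have := P.finiteIndex_center
  obtain ⟨h1, h2⟩ := finrank_isotypic hτ hπ hchar
  have hiso : ∀ ψt : X, Nonempty ((τ ψt).ρ.Equiv (π.isotypic ψt).toRepresentation) := fun ψt =>
    (hτ ψt).hasCentralChar.nonempty_equiv (π.isotypic_hasCentralChar ψt) ψt.1.isHeisenberg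
      (hτ ψt).1 ((π.isotypic_hasCentralChar ψt).isIrreducible_of_finrank ψt.1.isHeisenberg
        (by rw [h1, (hτ ψt).finrank_sq, P.index_Z0]))
  let e := fun ψt => (hiso ψt).some
  let F : (DirectSum X fun ψt => (τ ψt).V) →ₗ[ℂ] π.V := DirectSum.toModule ℂ X π.V fun ψt =>
    (π.isotypic ψt).toSubmodule.subtype ∘ₗ (e ψt).toLinearEquiv.toLinearMap
  have hF : ∀ ψt x, F (DirectSum.lof ℂ X (fun ψt => (τ ψt).V) ψt x) =
      (e ψt).toLinearEquiv x := fun ψt x => by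
    rw [DirectSum.toModule_lof]
    rfl
  have hsurj : Function.Surjective F := by
    rw [← LinearMap.range_eq_top, ← top_le_iff, ← π.iSup_isotypic hπ]
    refine iSup_le fun ψt => ?_
    by_cases hψt : ψt ∈ X
    · intro y hy
      obtain ⟨x, hx⟩ := (e ⟨ψt, hψt⟩).toLinearEquiv.surjective ⟨y, hy⟩
      exact ⟨_, (hF ⟨ψt, hψt⟩ x).trans (congrArg Subtype.val hx)⟩
    · rw [h2 ψt hψt]
      exact bot_le
  have hdim : finrank ℂ (directSum τ).V = finrank ℂ π.V := by
    have h3 := congrFun hchar 1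
    rw [character_one, character_one] at h3
    exact_mod_cast h3.symm
  have hinj : Function.Injective F :=
    (LinearMap.injective_iff_surjective_of_finrank_eq_finrank hdim).2 hsurj
  refine ⟨(Representation.Equiv.mk (LinearEquiv.ofBijective F ⟨hinj, hsurj⟩) fun g => ?_).symm⟩
  refine DirectSum.linearMap_ext _ fun ψt => LinearMap.ext fun x => ?_
  change F (Representation.directSum (fun ψt => (τ ψt).ρ) g (DirectSum.lof ℂ X _ ψt x)) =
    π.ρ g (F (DirectSum.lof ℂ X (fun ψt => (τ ψt).V) ψt x))
  rw [Representation.directSum_apply, DirectSum.lmap_lof, hF, hF]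
  exact congrArg Subtype.val
    (Representation.IntertwiningMap.isIntertwining _ _ (e ψt).toIntertwiningMap g x)

end Isotypic

end GenuineRep

/-! ### The lift as a sum of irreducible characters. -/

namespace TwoSubgroup

variable {Q : TwoSubgroup P}

/-- Both sides are compared on `S̃`, on the rest of the centre, where `sum_Xg` gives zero, and off
the centre, where each trace vanishes. -/
lemma lift_eq_sum_character {χt : P.GenuineChar} {χ ψ : Q.Gbar →ₜ* ℂˣ} {ψ₀ : Q.St →ₜ* ℂˣ}
    (hψ₀ : Q.IsPsi0 Q.St_le_center χt χ ψ ψ₀) [Fintype (Q.Xg Q.St_le_center ψ₀)]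
    {τ : Q.Xg Q.St_le_center ψ₀ → GenuineRep.{u, v} P} (hτ : ∀ ψt, (τ ψt).IsTau ψt) :
    Q.lift χt χ ψ = ∑ ψt, (τ ψt).character := by
  obtain ⟨τ₀, hτ₀⟩ := GenuineRep.exists_isTau.{u, 0} χt
  have hd : ∀ ψt, finrank ℂ (τ ψt).V = finrank ℂ τ₀.V := fun ψt =>
    Nat.pow_left_injective two_ne_zero ((hτ ψt).finrank_sq.trans hτ₀.finrank_sq.symm)
  funext g
  rw [Finset.sum_apply]
  by_cases hgS : g ∈ Q.St
  · lift g to Q.St using hgS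
    have h1 : ∀ ψt, (τ ψt).character g = ((ψ₀ g : ℂˣ) : ℂ) * finrank ℂ τ₀.V := fun ψt => by
      rw [(hτ ψt).character_center ⟨g, Q.St_le_center g.2⟩, hd, ψt.2 g]
    rw [lift_apply_St hψ₀ hτ₀.finrank_sq, Finset.sum_congr rfl fun ψt _ => h1 ψt, Finset.sum_const,
      Finset.card_univ, ← Nat.card_eq_fintype_card, card_Xg hψ₀.1, nsmul_eq_mul]
    ring
  · rw [lift_eq_zero_of_notMem _ _ _ hgS]
    by_cases hgZ : g ∈ Subgroup.center Gt
    · lift g to Subgroup.center Gt using hgZ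
      simp_rw [fun ψt => (hτ ψt).character_center g, hd]
      rw [← Finset.sum_mul, sum_Xg hψ₀.1 hgS, zero_mul]
    · exact (Finset.sum_eq_zero fun ψt _ => (hτ ψt).character_eq_zero hgZ).symm

lemma lift_ne_zero_iff (χt : P.GenuineChar) (χ ψ : Q.Gbar →ₜ* ℂˣ) :
    Q.lift χt χ ψ ≠ 0 ↔ ∀ t ∈ Q.φ.ker, χ t = ψ t := by
  refine ⟨fun h t ht => by_contra fun hne => h (lift_eq_zero χt χ ψ ht hne), fun h h0 => ?_⟩
  obtain ⟨ψ₀, hψ₀⟩ := Q.exists_psi0 χt χ ψ h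
  -- Only the dimension of `τ₀` is used: it is an integer square root of the index, and the lift at
  -- `1` is a nonzero multiple of it.
  obtain ⟨τ₀, hτ₀⟩ := GenuineRep.exists_isTau.{u, 0} χt
  have h1 := lift_apply_St hψ₀ hτ₀.finrank_sq 1
  rw [h0, Pi.zero_apply, map_one, Units.val_one, mul_one] at h1
  have h2 : finrank ℂ τ₀.V ≠ 0 := fun h => P.finiteIndex_Z0.1 (by rw [← hτ₀.finrank_sq, h]; rfl)
  have h3 := Q.relIndex_ne_zero
  exact mul_ne_zero (Nat.cast_ne_zero.2 h2) (Nat.cast_ne_zero.2 h3) h1.symm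

lemma St_eq_center (h : Q.φ.range = P.Z0) : Q.St = Subgroup.center Gt := by
  ext g
  rw [St, h, Subgroup.mem_comap, P.p_mem_Z0]

end TwoSubgroup

end TwoFoldCover

end

/-! ### Assembling the theorem. -/

namespace TwoFoldCover

variable {T : RealTorus} {Gt : Type u} [Group Gt] [TopologicalSpace Gt] [IsTopologicalGroup Gt]
  {P : TwoFoldCover T Gt} {Q : TwoSubgroup P}

lemma GenuineRep.Iso.trans_symm {π : GenuineRep.{u, v} P} {π' : GenuineRep.{u, w} P}
    {σ : GenuineRep P} (h : π.Iso σ) (h' : π'.Iso σ) : π.Iso π' := by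
  obtain ⟨e⟩ := h
  obtain ⟨e'⟩ := h'
  exact ⟨e.trans e'.symm⟩

lemma TwoSubgroup.lift_represented {χt : P.GenuineChar} {χ ψ : Q.Gbar →ₜ* ℂˣ}
    {ψ₀ : Q.St →ₜ* ℂˣ} (hψ₀ : Q.IsPsi0 Q.St_le_center χt χ ψ ψ₀)
    [Finite (Q.Xg Q.St_le_center ψ₀)]
    {τ : Q.Xg Q.St_le_center ψ₀ → GenuineRep.{u, v} P} (hτ : ∀ ψt, (τ ψt).IsTau ψt) :
    Q.lift χt χ ψ = ∑ᶠ ψt, (τ ψt).character ∧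
      (GenuineRep.directSum τ).Represents (Q.lift χt χ ψ) ∧
      ∀ π : GenuineRep.{u, w} P, π.Represents (Q.lift χt χ ψ) →
        π.Iso (GenuineRep.directSum τ) := by
  have := Fintype.ofFinite (Q.Xg Q.St_le_center ψ₀)
  have h1 := lift_eq_sum_character hψ₀ hτ
  have h2 : (GenuineRep.directSum τ).character = Q.lift χt χ ψ := by
    rw [h1, GenuineRep.character_directSum]
  refine ⟨by rw [finsum_eq_sum_of_fintype, h1], ⟨GenuineRep.isSemisimple_directSum τ fun ψt => ?_,
    h2⟩, fun π hπ => GenuineRep.iso_directSum hτ hπ.1 (hπ.2.trans h2.symm)⟩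
  have := (hτ ψt).1
  infer_instance

end TwoFoldCover

theorem propositionp {T : RealTorus} {Gt : Type u} [Group Gt] [TopologicalSpace Gt]
    [IsTopologicalGroup Gt] (P : TwoFoldCover T Gt) (Q : P.TwoSubgroup)
    (χt : P.GenuineChar) (χ ψ : Q.Gbar →ₜ* ℂˣ) :
    -- each genuine character of the centre determines the representation `τ̃`, up to isomorphism
    (∀ ψt : P.GenuineChar,
      (∃ τ : TwoFoldCover.GenuineRep.{u, v} P, τ.IsTau ψt) ∧
      ∀ (τ : TwoFoldCover.GenuineRep.{u, v} P) (τ' : TwoFoldCover.GenuineRep.{u, w} P),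
        τ.IsTau ψt → τ'.IsTau ψt → τ.Iso τ') ∧
    -- the lift is non-zero if and only if `χ = ψ` on the kernel of `φ`
    (Q.lift χt χ ψ ≠ 0 ↔ ∀ t ∈ Q.φ.ker, χ t = ψ t) ∧
    ∃ hS : Q.St ≤ Subgroup.center Gt,
    ((∀ t ∈ Q.φ.ker, χ t = ψ t) →
      ∃ ψ₀ : Q.St →ₜ* ℂˣ, Q.IsPsi0 hS χt χ ψ ψ₀ ∧
      -- the number of summands
      ∃ _ : Finite (Q.Xg hS ψ₀),
      Nat.card (Q.Xg hS ψ₀) = Q.φ.range.relIndex P.Z0 ∧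
      -- the lift is the direct sum of the representations `τ̃(ψ̃)`
      (∀ τ : Q.Xg hS ψ₀ → TwoFoldCover.GenuineRep.{u, v} P, (∀ ψt, (τ ψt).IsTau ψt) →
        Q.lift χt χ ψ = ∑ᶠ ψt, (τ ψt).character ∧
        (TwoFoldCover.GenuineRep.directSum τ).Represents (Q.lift χt χ ψ) ∧
        ∀ π : TwoFoldCover.GenuineRep.{u, w} P, π.Represents (Q.lift χt χ ψ) →
          π.Iso (TwoFoldCover.GenuineRep.directSum τ)) ∧
      -- the differentials
      (∃ dχt dχ dψ : T.lie →ₗ[ℝ] ℂ, P.HasDifferential χt.1 dχt ∧ Q.HasDifferential χ dχ ∧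
        Q.HasDifferential ψ dψ ∧
        ∀ ψt ∈ Q.Xg hS ψ₀,
          P.HasDifferential ψt.1 ((1 / 2 : ℝ) • (dψ - (dχ - (2 : ℝ) • dχt)))) ∧
      -- the special case where `φ(Ḡ) = p(Z(G̃))`
      (Q.φ.range = P.Z0 →
        Q.St = Subgroup.center Gt ∧
        ∃ ψ₁ : P.GenuineChar, (∀ s : Q.St, ψ₁.1 ⟨s, hS s.2⟩ = ψ₀ s) ∧ Q.Xg hS ψ₀ = {ψ₁} ∧
          ∀ τ : TwoFoldCover.GenuineRep.{u, v} P, τ.IsTau ψ₁ →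
            τ.Represents (Q.lift χt χ ψ) ∧
            ∀ π : TwoFoldCover.GenuineRep.{u, w} P, π.Represents (Q.lift χt χ ψ) →
              π.Iso τ)) := by
  have hS := Q.St_le_center
  refine ⟨fun ψt => ⟨TwoFoldCover.GenuineRep.exists_isTau ψt, fun τ τ' h h' => h.iso h'⟩,
    TwoFoldCover.TwoSubgroup.lift_ne_zero_iff χt χ ψ, hS, fun h => ?_⟩
  obtain ⟨ψ₀, hψ₀⟩ := Q.exists_psi0 χt χ ψ h
  have hfin := TwoFoldCover.TwoSubgroup.finite_Xg hψ₀.1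
  have hcard := TwoFoldCover.TwoSubgroup.card_Xg hψ₀.1
  refine ⟨ψ₀, hψ₀, hfin, hcard, fun τ hτ => TwoFoldCover.TwoSubgroup.lift_represented hψ₀ hτ,
    ?_, fun hZ => ?_⟩
  · obtain ⟨dχt, hχt⟩ := P.exists_differential χt.1
    obtain ⟨dχ, hχ⟩ := Q.exists_differential χ
    obtain ⟨dψ, hψ⟩ := Q.exists_differential ψ
    exact ⟨dχt, dχ, dψ, P.hasDifferential_of_hasDerivAt hχt, hχ, hψ, fun ψt hψt =>
      TwoFoldCover.TwoSubgroup.hasDifferential_Xg hψ₀ hχt hχ hψ hψt⟩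
  -- The index is now `1`, so `ψ̃₀` has a single extension. The direct sum over this one-element set
  -- serves as an intermediary: both `π` and `τ` are isomorphic to it.
  · rw [hZ, Subgroup.relIndex_self] at hcard
    obtain ⟨ψ₁, hψ₁⟩ := Set.ncard_eq_one.1 hcard
    have hmem : ψ₁ ∈ Q.Xg hS ψ₀ := hψ₁ ▸ Set.mem_singleton ψ₁
    refine ⟨TwoFoldCover.TwoSubgroup.St_eq_center hZ, ψ₁, hmem, hψ₁, fun τ hτ => ?_⟩
    have hall : ∀ ψt : Q.Xg hS ψ₀, (ψt : P.GenuineChar) = ψ₁ := fun ψt =>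
      Set.mem_singleton_iff.1 (hψ₁ ▸ ψt.2)
    have hτ' : ∀ ψt : Q.Xg hS ψ₀, τ.IsTau ψt := fun ψt => by rwa [hall]
    have huniq : Unique (Q.Xg hS ψ₀) := ⟨⟨⟨ψ₁, hmem⟩⟩, fun ψt => Subtype.ext (hall ψt)⟩
    have hrep : τ.Represents (Q.lift χt χ ψ) := by
      have := hτ.1
      refine ⟨inferInstance, ?_⟩
      rw [(TwoFoldCover.TwoSubgroup.lift_represented.{u, v, v} hψ₀ hτ').1, finsum_unique]
    exact ⟨hrep, fun π hπ => TwoFoldCover.GenuineRep.Iso.trans_symm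
      ((TwoFoldCover.TwoSubgroup.lift_represented hψ₀ hτ').2.2 π hπ)
      ((TwoFoldCover.TwoSubgroup.lift_represented hψ₀ hτ').2.2 τ hrep)⟩
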